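/- Let $(\Omega,\mathcal F,\mathbb P)$ be a probability space, $T>0$ and $H\in(\tfrac12,1)$. Let $W=(W_t)_{t\in[0,T]}$ be a standard Brownian motion and $B^H=(B^H_t)_{t\in[0,T]}$ a fractional Brownian motion with Hurst parameter $H$ (a centred Gaussian process with almost surely continuous paths and covariance $\tfrac12(s^{2H}+t^{2H}-|t-s|^{2H})$), independent of $W$, and let $X=W+B^H$. Let $\xi$ be a square integrable real random variable with a density $g_\xi$, independent of the filtration generated by $X$. For $t\in[0,T]$ and $x\in\mathbb R$ let $$\phi_W(t,x)=\int_0^t e^{ix(t-s)}\,dW_s := W_t+ix\int_0^t e^{ix(t-s)}W_s\,ds ,$$ the pathwise integral defined by integration by parts. Then, almost surely: (0) for all $t\in[0,T]$ and $x\in\mathbb R$, $\phi_W(t,x)$ is the Riemann--Stieltjes integral of $s\mapsto e^{ix(t-s)}$ against $W$ over $[0,t]$; (1) for every $x\in\mathbb R$ the integral $\int_0^T\phi_W(t,x)\,dB^H_t$ exists as a Riemann--Stieltjes integral, and $x\mapsto\big(\int_0^T\phi_W(t,x)\,dB^H_t\big)g_\xi(x)$ is Lebesgue integrable on $\mathbb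 R$; (2) for every $t\in[0,T]$ the function $x\mapsto\phi_W(t,x)g_\xi(x)$ is Lebesgue integrable on $\mathbb R$, and $t\mapsto\int_{\mathbb R}\phi_W(t,x)g_\xi(x)\,dx$ has a Riemann--Stieltjes integral against $B^H$ over $[0,T]$; (3) the two iterated integrals agree: $$\int_{\mathbb R}\Big(\int_0^T\phi_W(t,x)\,dB^H_t\Big)g_\xi(x)\,dx=\int_0^T\Big(\int_{\mathbb R}\phi_W(t,x)g_\xi(x)\,dx\Big)dB^H_t .$$ Here a Riemann--Stieltjes integral is the limit, path by path, of the Riemann--Stieltjes sums with arbitrary tags as the mesh of the partition tends to $0$. -/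

import Mathlib

open MeasureTheory ProbabilityTheory Set

/-- `W` is a standard Brownian motion on `[0,T]`: a centred Gaussian process with covariance
`min s t` and almost surely continuous paths. Only the values `W t` with `t ∈ [0,T]` matter. -/
structure IsStandardBrownianMotionOn {Ω : Type*} [MeasurableSpace Ω]
    (W : ℝ → Ω → ℝ) (T : ℝ) (P : Measure Ω) : Prop where
  gaussian : IsGaussianProcess (fun (t : Icc (0 : ℝ) T) ω => W t ω) P
  mean_zero : ∀ t ∈ Icc (0 : ℝ) T, ∫ ω, W t ω ∂P = 0
  covariance : ∀ s ∈ Icc (0 : ℝ) T, ∀ t ∈ Icc (0 : ℝ) T, cov[W s, W t; P] = min s t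
  continuous : ∀ᵐ ω ∂P, ContinuousOn (fun t => W t ω) (Icc 0 T)

/-- `B` is a fractional Brownian motion on `[0,T]` with Hurst parameter `H`: a centred Gaussian
process with covariance `(s ^ (2H) + t ^ (2H) - |t - s| ^ (2H)) / 2` and almost surely continuous
paths. Only the values `B t` with `t ∈ [0,T]` matter. -/
structure IsFractionalBrownianMotionOn {Ω : Type*} [MeasurableSpace Ω]
    (B : ℝ → Ω → ℝ) (H T : ℝ) (P : Measure Ω) : Prop where
  gaussian : IsGaussianProcess (fun (t : Icc (0 : ℝ) T) ω => B t ω) P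
  mean_zero : ∀ t ∈ Icc (0 : ℝ) T, ∫ ω, B t ω ∂P = 0
  covariance : ∀ s ∈ Icc (0 : ℝ) T, ∀ t ∈ Icc (0 : ℝ) T,
    cov[B s, B t; P] = (s ^ (2 * H) + t ^ (2 * H) - |t - s| ^ (2 * H)) / 2
  continuous : ∀ᵐ ω ∂P, ContinuousOn (fun t => B t ω) (Icc 0 T)

/-- The points `τ 0 ≤ τ 1 ≤ ⋯ ≤ τ n` form a partition of `[a,b]` of mesh less than `δ`, and
`σ i ∈ [τ i, τ (i+1)]` are tags for it. (Repeated points contribute nothing to the sums.) -/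
structure IsTaggedPartition (a b δ : ℝ) (n : ℕ) (τ σ : ℕ → ℝ) : Prop where
  left : τ 0 = a
  right : τ n = b
  le_tag : ∀ i < n, τ i ≤ σ i
  tag_le : ∀ i < n, σ i ≤ τ (i + 1)
  mesh : ∀ i < n, τ (i + 1) - τ i < δ

/-- The Riemann–Stieltjes sum `∑ f(σ i) (g(τ (i+1)) - g(τ i))`. -/
noncomputable def rsSum (f : ℝ → ℂ) (g : ℝ → ℝ) (n : ℕ) (τ σ : ℕ → ℝ) : ℂ :=
  ∑ i ∈ Finset.range n, f (σ i) * ((g (τ (i + 1)) - g (τ i) : ℝ) : ℂ)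

/-- The Riemann–Stieltjes integral of `f` against `g` over `[a,b]` exists and equals `z`: the
Riemann–Stieltjes sums, with arbitrary tags, converge to `z` as the mesh tends to `0`. -/
def HasRSIntegral (f : ℝ → ℂ) (g : ℝ → ℝ) (a b : ℝ) (z : ℂ) : Prop :=
  ∀ ε > 0, ∃ δ > 0, ∀ (n : ℕ) (τ σ : ℕ → ℝ),
    IsTaggedPartition a b δ n τ σ → ‖rsSum f g n τ σ - z‖ < ε

/-- The Riemann–Stieltjes integral of `f` against `g` over `[a,b]` exists. -/
def RSIntegrable (f : ℝ → ℂ) (g : ℝ → ℝ) (a b : ℝ) : Prop :=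
  ∃ z, HasRSIntegral f g a b z

open scoped Classical in
/-- The value of the Riemann–Stieltjes integral (`0` if it does not exist). -/
noncomputable def rsIntegral (f : ℝ → ℂ) (g : ℝ → ℝ) (a b : ℝ) : ℂ :=
  if h : RSIntegrable f g a b then h.choose else 0

theorem exists_isTaggedPartition {a b δ : ℝ} (hab : a ≤ b) (hδ : 0 < δ) :
    ∃ n τ σ, IsTaggedPartition a b δ n τ σ := by
  obtain ⟨n, hn⟩ := exists_nat_gt ((b - a) / δ)
  have hn0 : (0 : ℝ) < n := lt_of_le_of_lt (div_nonneg (sub_nonneg.2 hab) hδ.le) hn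
  have hs : ∀ i : ℕ, (a + ((i + 1 : ℕ) : ℝ) * ((b - a) / n)) - (a + (i : ℝ) * ((b - a) / n))
      = (b - a) / n := by
    intro i
    push_cast
    ring
  have hq : 0 ≤ (b - a) / n := div_nonneg (sub_nonneg.2 hab) hn0.le
  refine ⟨n, fun i => a + (i : ℝ) * ((b - a) / n), fun i => a + (i : ℝ) * ((b - a) / n), ?_⟩
  refine ⟨by simp, ?_, fun i _ => le_rfl, fun i _ => ?_, fun i _ => ?_⟩
  · change a + (n : ℝ) * ((b - a) / n) = b
    field_simp
    ring
  · have := hs i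
    linarith
  · simp only [hs i]
    rw [div_lt_iff₀ hδ] at hn
    rw [div_lt_iff₀ hn0]
    linarith

theorem IsTaggedPartition.mono {a b δ δ' : ℝ} {n : ℕ} {τ σ : ℕ → ℝ}
    (h : IsTaggedPartition a b δ n τ σ) (hδ : δ ≤ δ') : IsTaggedPartition a b δ' n τ σ :=
  ⟨h.left, h.right, h.le_tag, h.tag_le, fun i hi => (h.mesh i hi).trans_le hδ⟩

/-- The value of a Riemann–Stieltjes integral is unique. -/
theorem HasRSIntegral.unique {f : ℝ → ℂ} {g : ℝ → ℝ} {a b : ℝ} {z w : ℂ} (hab : a ≤ b)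
    (hz : HasRSIntegral f g a b z) (hw : HasRSIntegral f g a b w) : z = w := by
  by_contra hne
  have hpos : 0 < ‖z - w‖ / 2 := half_pos (norm_pos_iff.2 (sub_ne_zero.2 hne))
  obtain ⟨δ₁, h₁, H₁⟩ := hz _ hpos
  obtain ⟨δ₂, h₂, H₂⟩ := hw _ hpos
  obtain ⟨n, τ, σ, h⟩ := exists_isTaggedPartition hab (lt_min h₁ h₂)
  have A := H₁ n τ σ (h.mono (min_le_left _ _))
  have B := H₂ n τ σ (h.mono (min_le_right _ _))
  have C : ‖z - w‖ ≤ ‖rsSum f g n τ σ - w‖ + ‖rsSum f g n τ σ - z‖ := by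
    have := norm_sub_le (rsSum f g n τ σ - w) (rsSum f g n τ σ - z)
    rwa [sub_sub_sub_cancel_left] at this
  linarith

theorem HasRSIntegral.rsIntegral_eq {f : ℝ → ℂ} {g : ℝ → ℝ} {a b : ℝ} {z : ℂ} (hab : a ≤ b)
    (hz : HasRSIntegral f g a b z) : rsIntegral f g a b = z := by
  have h : RSIntegrable f g a b := ⟨z, hz⟩
  rw [rsIntegral, dif_pos h]
  exact h.choose_spec.unique hab hz

/-- The pathwise integral `∫₀ᵗ e^{iλs} dw_s` of a path `w` with `w 0 = 0`, defined by
integration by parts as `e^{iλt} w_t - iλ ∫₀ᵗ w_s e^{iλs} ds`. -/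
noncomputable def pathExpIntegral (lam : ℝ) (w : ℝ → ℝ) (t : ℝ) : ℂ :=
  Complex.exp (Complex.I * lam * t) * w t
    - Complex.I * lam * ∫ s in (0 : ℝ)..t, (w s : ℂ) * Complex.exp (Complex.I * lam * s)

/-- `φ_w(t,x) = ∫₀ᵗ e^{ix(t-s)} dw_s = e^{ixt} ∫₀ᵗ e^{-ixs} dw_s`. -/
noncomputable def phiPath (w : ℝ → ℝ) (t x : ℝ) : ℂ :=
  Complex.exp (Complex.I * x * t) * pathExpIntegral (-x) w t

/-! The argument is pathwise. Write `φ_w(t,x) = w_t + D(t,x)` with `D(t,x) = ix ∫₀ᵗ e^{ix(t-s)} w_s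
ds`. The rough summand `w_t` does not depend on `x`, so for it the exchange of integrals is
linearity, once `∫ w db` is known to exist. The summand `D` is `C¹` in `t` with derivative `ix φ_w`;
integration by parts (`hasRSIntegral_of_primitive`) turns its integral against `b` into a Lebesgue
integral of `b ∂ₜD`, and the classical Fubini theorem applies. Since `∂ₜD` grows at most
quadratically in `x`, the domination needed is exactly the second moment of `ξ`
(`phiPath_rsIntegral_fubini`).

The existence of `∫ W dB` is Young's theorem (`rsIntegrable_of_holder`): paths of `W` are Hölder of
every order below `1/2`, paths of `B` of every order below `H > 1/2`, so the two exponents can be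
chosen with sum above `1`. Young's theorem follows from a bound on the sums that is uniform over all
partitions, combined with approximation of the integrand by moving averages. Hölder regularity comes
from Kolmogorov's criterion (`ae_holder_of_moment`) and Gaussian moments of high order. -/

open Filter Topology

open scoped ENNReal NNReal

/-! ### Tagged partitions and elementary properties of Riemann–Stieltjes sums. -/

section Partitions

variable {a b δ : ℝ} {n : ℕ} {τ σ : ℕ → ℝ}

theorem IsTaggedPartition.le_succ (h : IsTaggedPartition a b δ n τ σ) {i : ℕ} (hi : i < n) :
    τ i ≤ τ (i + 1) :=
  (h.le_tag i hi).trans (h.tag_le i hi)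

theorem IsTaggedPartition.point_mem (h : IsTaggedPartition a b δ n τ σ) {i : ℕ} (hi : i ≤ n) :
    τ i ∈ Icc a b := by
  constructor
  · rw [← h.left]
    induction i with
    | zero => exact le_rfl
    | succ k ih => exact (ih (by omega)).trans (h.le_succ (by omega))
  · rw [← h.right]
    induction hi using Nat.decreasingInduction with
    | self => exact le_rfl
    | of_succ k hk ih => exact (h.le_succ hk).trans ih

theorem IsTaggedPartition.tag_mem (h : IsTaggedPartition a b δ n τ σ) {i : ℕ} (hi : i < n) :
    σ i ∈ Icc a b :=
  ⟨(h.point_mem hi.le).1.trans (h.le_tag i hi), (h.tag_le i hi).trans (h.point_mem hi).2⟩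

end Partitions

theorem rsSum_congr {f f' : ℝ → ℂ} {g g' : ℝ → ℝ} {a b δ : ℝ} {n : ℕ} {τ σ : ℕ → ℝ}
    (hf : EqOn f f' (Icc a b)) (hg : EqOn g g' (Icc a b)) (h : IsTaggedPartition a b δ n τ σ) :
    rsSum f g n τ σ = rsSum f' g' n τ σ := by
  refine Finset.sum_congr rfl fun i hi => ?_
  rw [Finset.mem_range] at hi
  rw [hf (h.tag_mem hi), hg (h.point_mem hi.le), hg (h.point_mem hi)]

theorem hasRSIntegral_congr {f f' : ℝ → ℂ} {g g' : ℝ → ℝ} {a b : ℝ} {z : ℂ}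
    (hf : EqOn f f' (Icc a b)) (hg : EqOn g g' (Icc a b)) :
    HasRSIntegral f g a b z ↔ HasRSIntegral f' g' a b z := by
  have key : ∀ δ n τ σ, IsTaggedPartition a b δ n τ σ → rsSum f g n τ σ = rsSum f' g' n τ σ :=
    fun δ n τ σ h => rsSum_congr hf hg h
  constructor <;> intro H ε hε <;> obtain ⟨δ, hδ, hH⟩ := H ε hε <;>
    refine ⟨δ, hδ, fun n τ σ h => ?_⟩
  · rw [← key δ n τ σ h]; exact hH n τ σ h
  · rw [key δ n τ σ h]; exact hH n τ σ h

theorem rsIntegrable_congr {f f' : ℝ → ℂ} {g g' : ℝ → ℝ} {a b : ℝ}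
    (hf : EqOn f f' (Icc a b)) (hg : EqOn g g' (Icc a b)) :
    RSIntegrable f g a b ↔ RSIntegrable f' g' a b :=
  exists_congr fun _ => hasRSIntegral_congr hf hg

/-- The predicates "has value `z`" are equal as functions of `z`, so the chosen witnesses coincide;
uniqueness of the value, and hence `a ≤ b`, is not needed. -/
theorem rsIntegral_congr {f f' : ℝ → ℂ} {g g' : ℝ → ℝ} {a b : ℝ}
    (hf : EqOn f f' (Icc a b)) (hg : EqOn g g' (Icc a b)) :
    rsIntegral f g a b = rsIntegral f' g' a b := by
  have h : HasRSIntegral f g a b = HasRSIntegral f' g' a b :=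
    funext fun z => propext (hasRSIntegral_congr hf hg)
  unfold rsIntegral RSIntegrable
  rw [h]

theorem rsSum_add (f f' : ℝ → ℂ) (g : ℝ → ℝ) (n : ℕ) (τ σ : ℕ → ℝ) :
    rsSum (fun t => f t + f' t) g n τ σ = rsSum f g n τ σ + rsSum f' g n τ σ := by
  simp only [rsSum, add_mul, Finset.sum_add_distrib]

theorem rsSum_sub (f f' : ℝ → ℂ) (g : ℝ → ℝ) (n : ℕ) (τ σ : ℕ → ℝ) :
    rsSum (fun t => f t - f' t) g n τ σ = rsSum f g n τ σ - rsSum f' g n τ σ := by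
  simp only [rsSum, sub_mul, Finset.sum_sub_distrib]

theorem rsSum_const_mul (c : ℂ) (f : ℝ → ℂ) (g : ℝ → ℝ) (n : ℕ) (τ σ : ℕ → ℝ) :
    rsSum (fun t => c * f t) g n τ σ = c * rsSum f g n τ σ := by
  simp only [rsSum, Finset.mul_sum, mul_assoc]

theorem HasRSIntegral.add {f f' : ℝ → ℂ} {g : ℝ → ℝ} {a b : ℝ} {z z' : ℂ}
    (h : HasRSIntegral f g a b z) (h' : HasRSIntegral f' g a b z') :
    HasRSIntegral (fun t => f t + f' t) g a b (z + z') := by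
  intro ε hε
  obtain ⟨δ, hδ, H⟩ := h (ε / 2) (half_pos hε)
  obtain ⟨δ', hδ', H'⟩ := h' (ε / 2) (half_pos hε)
  refine ⟨min δ δ', lt_min hδ hδ', fun n τ σ hp => ?_⟩
  have h1 := H n τ σ (hp.mono (min_le_left _ _))
  have h2 := H' n τ σ (hp.mono (min_le_right _ _))
  rw [rsSum_add, add_sub_add_comm]
  exact (norm_add_le _ _).trans_lt (by linarith)

theorem HasRSIntegral.const_mul {f : ℝ → ℂ} {g : ℝ → ℝ} {a b : ℝ} {z : ℂ} (c : ℂ)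
    (h : HasRSIntegral f g a b z) : HasRSIntegral (fun t => c * f t) g a b (c * z) := by
  intro ε hε
  have hc : 0 < ‖c‖ + 1 := by positivity
  obtain ⟨δ, hδ, H⟩ := h (ε / (‖c‖ + 1)) (div_pos hε hc)
  refine ⟨δ, hδ, fun n τ σ hp => ?_⟩
  have h1 := H n τ σ hp
  rw [lt_div_iff₀ hc] at h1
  rw [rsSum_const_mul, ← mul_sub, norm_mul]
  nlinarith [norm_nonneg (rsSum f g n τ σ - z)]

/-- Cauchy criterion for the existence of a Riemann–Stieltjes integral. -/
theorem rsIntegrable_of_cauchy {f : ℝ → ℂ} {g : ℝ → ℝ} {a b : ℝ} (hab : a ≤ b)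
    (H : ∀ ε > 0, ∃ δ > 0, ∀ n τ σ n' τ' σ', IsTaggedPartition a b δ n τ σ →
      IsTaggedPartition a b δ n' τ' σ' → ‖rsSum f g n τ σ - rsSum f g n' τ' σ'‖ < ε) :
    RSIntegrable f g a b := by
  choose N τ σ hp using fun m : ℕ => exists_isTaggedPartition hab (Nat.one_div_pos_of_nat (n := m))
  have hfine : ∀ δ > 0, ∃ M, ∀ m ≥ M, IsTaggedPartition a b δ (N m) (τ m) (σ m) := by
    intro δ hδ
    obtain ⟨M, hM⟩ := exists_nat_one_div_lt hδ
    exact ⟨M, fun m hm => (hp m).mono ((Nat.one_div_le_one_div hm).trans hM.le)⟩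
  have hcau : CauchySeq fun m => rsSum f g (N m) (τ m) (σ m) := by
    rw [Metric.cauchySeq_iff]
    intro ε hε
    obtain ⟨δ, hδ, hH⟩ := H ε hε
    obtain ⟨M, hM⟩ := hfine δ hδ
    exact ⟨M, fun m hm k hk => by
      rw [dist_eq_norm]; exact hH _ _ _ _ _ _ (hM m hm) (hM k hk)⟩
  obtain ⟨z, hz⟩ := cauchySeq_tendsto_of_complete hcau
  refine ⟨z, fun ε hε => ?_⟩
  obtain ⟨δ, hδ, hH⟩ := H (ε / 2) (half_pos hε)
  obtain ⟨M, hM⟩ := hfine δ hδ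
  refine ⟨δ, hδ, fun n τ' σ' hp' => ?_⟩
  have hlim : Tendsto (fun m => ‖rsSum f g n τ' σ' - rsSum f g (N m) (τ m) (σ m)‖) atTop
      (𝓝 ‖rsSum f g n τ' σ' - z‖) := (tendsto_const_nhds.sub hz).norm
  have := le_of_tendsto hlim (eventually_atTop.2 ⟨M, fun m hm => (hH _ _ _ _ _ _ hp' (hM m hm)).le⟩)
  linarith

/-- A function whose Riemann–Stieltjes sums are uniformly approximated by those of integrable
functions is integrable. -/
theorem rsIntegrable_of_approx {f : ℝ → ℂ} {g : ℝ → ℝ} {a b : ℝ} (hab : a ≤ b)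
    (H : ∀ ε > 0, ∃ f' : ℝ → ℂ, RSIntegrable f' g a b ∧ ∀ δ n τ σ, IsTaggedPartition a b δ n τ σ →
      ‖rsSum f g n τ σ - rsSum f' g n τ σ‖ ≤ ε) :
    RSIntegrable f g a b := by
  refine rsIntegrable_of_cauchy hab fun ε hε => ?_
  obtain ⟨f', ⟨z, hz⟩, hf'⟩ := H (ε / 5) (by positivity)
  obtain ⟨δ, hδ, hz⟩ := hz (ε / 5) (by positivity)
  refine ⟨δ, hδ, fun n τ σ n' τ' σ' h h' => ?_⟩
  have e : rsSum f g n τ σ - rsSum f g n' τ' σ' = (rsSum f g n τ σ - rsSum f' g n τ σ)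
      - (rsSum f g n' τ' σ' - rsSum f' g n' τ' σ') + (rsSum f' g n τ σ - z)
      - (rsSum f' g n' τ' σ' - z) := by ring
  rw [e]
  refine (norm_sub_le _ _).trans_lt ?_
  have h1 := norm_add_le ((rsSum f g n τ σ - rsSum f' g n τ σ)
      - (rsSum f g n' τ' σ' - rsSum f' g n' τ' σ')) (rsSum f' g n τ σ - z)
  have h2 := norm_sub_le (rsSum f g n τ σ - rsSum f' g n τ σ)
    (rsSum f g n' τ' σ' - rsSum f' g n' τ' σ')
  have := hf' _ _ _ _ h
  have := hf' _ _ _ _ h'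
  have := hz _ _ _ h
  have := hz _ _ _ h'
  linarith

/-! ### Integration by parts. -/

theorem norm_integral_sub_const_mul_le {h : ℝ → ℂ} {g : ℝ → ℝ} {u v c ε : ℝ} (huv : u ≤ v)
    (hh : IntervalIntegrable h volume u v)
    (hc : ∀ s ∈ Icc u v, |g s - c| ≤ ε) :
    ‖∫ s in u..v, ((g s - c : ℝ) : ℂ) * h s‖ ≤ ε * ∫ s in u..v, ‖h s‖ := by
  rw [← intervalIntegral.integral_const_mul]
  refine intervalIntegral.norm_integral_le_of_norm_le huv
    (Filter.Eventually.of_forall fun s hs => ?_) (hh.norm.const_mul ε)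
  rw [norm_mul, Complex.norm_real]
  exact mul_le_mul_of_nonneg_right (hc s ⟨hs.1.le, hs.2⟩) (norm_nonneg _)

/-- Riemann–Stieltjes integration by parts for an absolutely continuous integrand and a continuous
integrator. -/
theorem hasRSIntegral_of_primitive {f h : ℝ → ℂ} {g : ℝ → ℝ} {a b : ℝ} (hab : a ≤ b)
    (hg : ContinuousOn g (Icc a b)) (hh : IntervalIntegrable h volume a b)
    (hf : ∀ s ∈ Icc a b, ∀ t ∈ Icc a b, f t - f s = ∫ u in s..t, h u) :
    HasRSIntegral f g a b (f b * g b - f a * g a - ∫ s in a..b, (g s : ℂ) * h s) := by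
  intro ε hε
  have hI0 : 0 ≤ ∫ s in a..b, ‖h s‖ :=
    intervalIntegral.integral_nonneg hab fun _ _ => norm_nonneg _
  set I := ∫ s in a..b, ‖h s‖ with hI
  have hη : 0 < ε / (I + 1) := by positivity
  obtain ⟨δ, hδ, hunif⟩ := Metric.uniformContinuousOn_iff.1
    (isCompact_Icc.uniformContinuousOn_of_continuous hg) _ hη
  refine ⟨δ, hδ, fun n τ σ hp => ?_⟩
  have hsub : ∀ {s t}, s ∈ Icc a b → t ∈ Icc a b → IntervalIntegrable h volume s t :=
    fun hs ht => hh.mono_set (by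
      rw [uIcc_of_le hab]; exact (convex_Icc a b).ordConnected.uIcc_subset hs ht)
  have hgh : ∀ {s t}, s ∈ Icc a b → t ∈ Icc a b →
      IntervalIntegrable (fun u => (g u : ℂ) * h u) volume s t := fun hs ht =>
    (hsub hs ht).continuousOn_mul
      (Complex.continuous_ofReal.comp_continuousOn (hg.mono
        ((convex_Icc a b).ordConnected.uIcc_subset hs ht)))
  have ha : a ∈ Icc a b := left_mem_Icc.2 hab
  have hb : b ∈ Icc a b := right_mem_Icc.2 hab
  have tele : f b * g b - f a * g a = ∑ i ∈ Finset.range n,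
      (f (τ (i + 1)) * g (τ (i + 1)) - f (τ i) * g (τ i)) := by
    rw [Finset.sum_range_sub (fun i => f (τ i) * (g (τ i) : ℂ)), hp.left, hp.right]
  have split1 : (∫ s in a..b, (g s : ℂ) * h s) = ∑ i ∈ Finset.range n,
      ∫ s in (τ i)..(τ (i + 1)), (g s : ℂ) * h s := by
    rw [intervalIntegral.sum_integral_adjacent_intervals fun k hk =>
      hgh (hp.point_mem hk.le) (hp.point_mem hk), hp.left, hp.right]
  have split2 : I = ∑ i ∈ Finset.range n, ∫ s in (τ i)..(τ (i + 1)), ‖h s‖ := by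
    rw [intervalIntegral.sum_integral_adjacent_intervals fun k hk =>
      (hsub (hp.point_mem hk.le) (hp.point_mem hk)).norm, hp.left, hp.right]
  -- Splitting the cell at its tag, the discrepancy is an integral of `h` against `g s - g (τ i)` to
  -- the left of the tag and `g s - g (τ (i + 1))` to the right; both factors are small by uniform
  -- continuity of `g`.
  have hterm : ∀ i ∈ Finset.range n,
      ‖f (σ i) * ((g (τ (i + 1)) - g (τ i) : ℝ) : ℂ)
        - ((f (τ (i + 1)) * g (τ (i + 1)) - f (τ i) * g (τ i))
          - ∫ s in (τ i)..(τ (i + 1)), (g s : ℂ) * h s)‖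
        ≤ ε / (I + 1) * ∫ s in (τ i)..(τ (i + 1)), ‖h s‖ := by
    intro i hi
    rw [Finset.mem_range] at hi
    have m0 := hp.point_mem hi.le
    have m1 := hp.point_mem hi
    have ms := hp.tag_mem hi
    have l1 := hp.le_tag i hi
    have l2 := hp.tag_le i hi
    have lm := hp.mesh i hi
    have e : f (σ i) * ((g (τ (i + 1)) - g (τ i) : ℝ) : ℂ)
        - ((f (τ (i + 1)) * g (τ (i + 1)) - f (τ i) * g (τ i))
          - ∫ s in (τ i)..(τ (i + 1)), (g s : ℂ) * h s)
        = (∫ s in (τ i)..(σ i), ((g s - g (τ i) : ℝ) : ℂ) * h s)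
          + ∫ s in (σ i)..(τ (i + 1)), ((g s - g (τ (i + 1)) : ℝ) : ℂ) * h s := by
      rw [← intervalIntegral.integral_add_adjacent_intervals (hgh m0 ms) (hgh ms m1)]
      have e1 := hf _ m0 _ ms
      have e2 := hf _ ms _ m1
      simp only [Complex.ofReal_sub, sub_mul]
      rw [intervalIntegral.integral_sub (hgh m0 ms) ((hsub m0 ms).const_mul _),
        intervalIntegral.integral_sub (hgh ms m1) ((hsub ms m1).const_mul _),
        intervalIntegral.integral_const_mul, intervalIntegral.integral_const_mul, ← e1, ← e2]
      ring
    rw [e, ← intervalIntegral.integral_add_adjacent_intervals (hsub m0 ms).norm (hsub ms m1).norm,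
      mul_add]
    refine (norm_add_le _ _).trans (add_le_add ?_ ?_)
    · refine norm_integral_sub_const_mul_le l1 (hsub m0 ms) fun s hs => ?_
      have hs' : s ∈ Icc a b := ⟨m0.1.trans hs.1, hs.2.trans ms.2⟩
      refine (hunif s hs' _ m0 ?_).le
      rw [Real.dist_eq, abs_of_nonneg (by linarith [hs.1])]
      linarith [hs.2]
    · refine norm_integral_sub_const_mul_le l2 (hsub ms m1) fun s hs => ?_
      have hs' : s ∈ Icc a b := ⟨ms.1.trans hs.1, hs.2.trans m1.2⟩
      refine (hunif s hs' _ m1 ?_).le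
      rw [Real.dist_eq, abs_of_nonpos (by linarith [hs.2])]
      linarith [hs.1]
  rw [tele, split1, ← Finset.sum_sub_distrib, rsSum, ← Finset.sum_sub_distrib]
  refine (norm_sum_le_of_le _ hterm).trans_lt ?_
  rw [← Finset.mul_sum, ← split2, div_mul_eq_mul_div, div_lt_iff₀ (by positivity)]
  nlinarith

/-! ### Young's inequality by successive deletion of partition points. -/

/-- Deleting the point `τ (m + 1)` and the tag `σ (m + 1)` from a Riemann–Stieltjes sum. -/
theorem rsSum_sub_rsSum_delete (f : ℝ → ℂ) (g : ℝ → ℝ) (m l : ℕ) (τ σ : ℕ → ℝ) :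
    rsSum f g (m + 1 + l + 1) τ σ
      - rsSum f g (m + 1 + l) (fun j => τ (if j < m + 1 then j else j + 1))
          (fun j => σ (if j < m + 1 then j else j + 1))
      = (f (σ (m + 1)) - f (σ m)) * ((g (τ (m + 2)) - g (τ (m + 1)) : ℝ) : ℂ) := by
  have h1 : m + 1 + l + 1 = m + 1 + 1 + l := by ring
  rw [h1]
  simp only [rsSum]
  rw [Finset.sum_range_add, Finset.sum_range_add _ (m + 1) l, Finset.sum_range_succ _ (m + 1),
    Finset.sum_range_succ _ m, Finset.sum_range_succ _ m]
  have h2 : ∀ i ∈ Finset.range m,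
      f (σ (if i < m + 1 then i else i + 1)) *
        ((g (τ (if i + 1 < m + 1 then i + 1 else i + 1 + 1))
          - g (τ (if i < m + 1 then i else i + 1)) : ℝ) : ℂ)
      = f (σ i) * ((g (τ (i + 1)) - g (τ i) : ℝ) : ℂ) := by
    intro i hi
    rw [Finset.mem_range] at hi
    rw [if_pos (by omega), if_pos (by omega)]
  have h3 : ∀ i ∈ Finset.range l,
      f (σ (if m + 1 + i < m + 1 then m + 1 + i else m + 1 + i + 1)) *
        ((g (τ (if m + 1 + i + 1 < m + 1 then m + 1 + i + 1 else m + 1 + i + 1 + 1))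
          - g (τ (if m + 1 + i < m + 1 then m + 1 + i else m + 1 + i + 1)) : ℝ) : ℂ)
      = f (σ (m + 1 + 1 + i)) * ((g (τ (m + 1 + 1 + i + 1)) - g (τ (m + 1 + 1 + i)) : ℝ) : ℂ) := by
    intro i _
    rw [if_neg (by omega), if_neg (by omega), show m + 1 + i + 1 = m + 1 + 1 + i by ring]
  rw [Finset.sum_congr rfl h2, Finset.sum_congr rfl h3, if_pos (by omega), if_neg (by omega)]
  push_cast
  ring

/-- Among the intervals `[τ i, τ (i + 2)]` of a partition there is a short one. -/
theorem exists_two_step_le {a b δ : ℝ} {n : ℕ} {τ σ : ℕ → ℝ}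
    (h : IsTaggedPartition a b δ (n + 2) τ σ) :
    ∃ m ≤ n, τ (m + 2) - τ m ≤ 2 * (b - a) / (n + 1 : ℕ) := by
  by_contra! hlt
  -- The `n + 1` double steps cover each cell at most twice, so their lengths add up to at most `2 *
  -- (b - a)` and cannot all exceed the average.
  have hsum : ∑ i ∈ Finset.range (n + 1), (2 * (b - a) / (n + 1 : ℕ))
      < ∑ i ∈ Finset.range (n + 1), ((τ (i + 1 + 1) - τ (i + 1)) + (τ (i + 1) - τ i)) := by
    refine Finset.sum_lt_sum_of_nonempty (by simp) fun i hi => ?_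
    have := hlt i (by rw [Finset.mem_range] at hi; omega)
    linarith
  rw [Finset.sum_add_distrib, Finset.sum_range_sub (fun i => τ (i + 1)), Finset.sum_range_sub,
    Finset.sum_const, Finset.card_range, nsmul_eq_mul, mul_div_cancel₀ _ (by positivity),
    zero_add] at hsum
  have h0 := h.left
  have h1 := h.right
  have h2 := (h.point_mem (i := 1) (by omega)).1
  have h3 := (h.point_mem (i := n + 1) (by omega)).2
  linarith

/-- Young's inequality for tagged Riemann–Stieltjes sums of Hölder functions. -/
theorem norm_rsSum_sub_le {f : ℝ → ℂ} {g : ℝ → ℝ} {a b A C α β : ℝ} (hA : 0 ≤ A)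
    (hC : 0 ≤ C) (hα : 0 ≤ α) (hβ : 0 ≤ β)
    (hf : ∀ s ∈ Icc a b, ∀ t ∈ Icc a b, ‖f t - f s‖ ≤ A * |t - s| ^ α)
    (hg : ∀ s ∈ Icc a b, ∀ t ∈ Icc a b, |g t - g s| ≤ C * |t - s| ^ β) (n : ℕ) :
    ∀ (δ : ℝ) (τ σ : ℕ → ℝ), IsTaggedPartition a b δ (n + 1) τ σ →
      ‖rsSum f g (n + 1) τ σ - f (σ 0) * ((g b - g a : ℝ) : ℂ)‖
        ≤ A * C * (2 * (b - a)) ^ (α + β) * ∑ k ∈ Finset.range n, 1 / ((k + 1 : ℕ) : ℝ) ^ (α + β) := by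
  induction n with
  | zero =>
    intro δ τ σ h
    have h0 := h.left
    have h1 := h.right
    rw [zero_add] at h1
    simp [rsSum, h0, h1]
  | succ n ih =>
    intro δ τ σ h
    -- The interior point of the shortest available double step is deleted. The sum then changes by
    -- one product of increments of `f` and `g` over that double step, which yields the next term of
    -- the series.
    obtain ⟨m, hm, hmle⟩ := exists_two_step_le h
    obtain ⟨l, rfl⟩ := Nat.exists_eq_add_of_le hm
    have hdel := rsSum_sub_rsSum_delete f g m l τ σ
    set τ' : ℕ → ℝ := fun j => τ (if j < m + 1 then j else j + 1) with hτ'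
    set σ' : ℕ → ℝ := fun j => σ (if j < m + 1 then j else j + 1) with hσ'
    have hab : a ≤ b := (h.point_mem (i := 0) (by omega)).1.trans (h.point_mem (by omega)).2
    -- The surviving tag `σ m` still lies in the merged cell. The mesh `b - a + 1` is a dummy: the
    -- bound does not involve the mesh.
    have hp' : IsTaggedPartition a b (b - a + 1) (m + l + 1) τ' σ' := by
      have hmem : ∀ i ≤ m + l + 1, τ' i ∈ Icc a b := by
        intro i hi
        simp only [hτ']
        split_ifs
        · exact h.point_mem (by omega)
        · exact h.point_mem (by omega)
      refine ⟨?_, ?_, fun i hi => ?_, fun i hi => ?_, fun i hi => ?_⟩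
      · simp [hτ', h.left]
      · have := h.right
        simp only [hτ']
        rwa [if_neg (by omega)]
      · simp only [hτ', hσ']
        split_ifs
        · exact h.le_tag _ (by omega)
        · exact h.le_tag _ (by omega)
      · simp only [hτ', hσ']
        split_ifs
        · exact h.tag_le _ (by omega)
        · exact (h.tag_le _ (by omega)).trans (h.le_succ (by omega))
        · omega
        · exact h.tag_le _ (by omega)
      · have := hmem i (by omega)
        have := hmem (i + 1) (by omega)
        simp only [mem_Icc] at *
        linarith
    have hstep : ‖(f (σ (m + 1)) - f (σ m)) * ((g (τ (m + 2)) - g (τ (m + 1)) : ℝ) : ℂ)‖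
        ≤ A * C * (2 * (b - a)) ^ (α + β) * (1 / ((m + l + 1 : ℕ) : ℝ) ^ (α + β)) := by
      have hσ1 : τ (m + 1) ≤ σ (m + 1) := h.le_tag _ (by omega)
      have hσ2 : σ (m + 1) ≤ τ (m + 2) := h.tag_le _ (by omega)
      have hσ3 : τ m ≤ σ m := h.le_tag _ (by omega)
      have hσ4 : σ m ≤ τ (m + 1) := h.tag_le _ (by omega)
      set D := τ (m + 2) - τ m with hD
      have hD0 : 0 ≤ D := by linarith
      have b1 : ‖f (σ (m + 1)) - f (σ m)‖ ≤ A * D ^ α := by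
        refine (hf _ (h.tag_mem (by omega)) _ (h.tag_mem (by omega))).trans ?_
        gcongr
        rw [abs_of_nonneg (by linarith)]
        linarith
      have b2 : |g (τ (m + 2)) - g (τ (m + 1))| ≤ C * D ^ β := by
        refine (hg _ (h.point_mem (by omega)) _ (h.point_mem (by omega))).trans ?_
        gcongr
        rw [abs_of_nonneg (by linarith)]
        linarith
      rw [norm_mul, Complex.norm_real, Real.norm_eq_abs]
      calc ‖f (σ (m + 1)) - f (σ m)‖ * |g (τ (m + 2)) - g (τ (m + 1))|
          ≤ A * D ^ α * (C * D ^ β) := by gcongr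
        _ = A * C * D ^ (α + β) := by rw [Real.rpow_add_of_nonneg hD0 hα hβ]; ring
        _ ≤ A * C * (2 * (b - a) / (m + l + 1 : ℕ)) ^ (α + β) := by gcongr
        _ = _ := by
          rw [Real.div_rpow (by linarith) (by positivity)]
          ring
    have hsplit : rsSum f g (m + l + 1 + 1) τ σ - f (σ 0) * ((g b - g a : ℝ) : ℂ)
        = (f (σ (m + 1)) - f (σ m)) * ((g (τ (m + 2)) - g (τ (m + 1)) : ℝ) : ℂ)
          + (rsSum f g (m + l + 1) τ' σ' - f (σ' 0) * ((g b - g a : ℝ) : ℂ)) := by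
      -- The deleted index `m + 1` is never `0`, so the reference value `f (σ 0)` survives the
      -- induction.
      have h0 : σ' 0 = σ 0 := by simp [hσ']
      rw [h0, ← hdel, show m + 1 + l = m + l + 1 by ring]
      ring
    rw [hsplit, Finset.sum_range_succ, mul_add, add_comm (A * C * _ * _)]
    exact (norm_add_le _ _).trans (add_le_add hstep (ih _ _ _ hp'))

/-- The series converges because `α + β > 1`, which makes the bound independent of the partition. An
integrand small in sup norm and in Hölder seminorm therefore has uniformly small sums. -/
theorem norm_rsSum_le {f : ℝ → ℂ} {g : ℝ → ℝ} {a b A C F α β : ℝ} (hA : 0 ≤ A)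
    (hC : 0 ≤ C) (hα : 0 ≤ α) (hβ : 0 ≤ β) (hαβ : 1 < α + β) (hab : a ≤ b)
    (hf : ∀ s ∈ Icc a b, ∀ t ∈ Icc a b, ‖f t - f s‖ ≤ A * |t - s| ^ α)
    (hF : ∀ s ∈ Icc a b, ‖f s‖ ≤ F)
    (hg : ∀ s ∈ Icc a b, ∀ t ∈ Icc a b, |g t - g s| ≤ C * |t - s| ^ β)
    {δ : ℝ} {n : ℕ} {τ σ : ℕ → ℝ} (h : IsTaggedPartition a b δ n τ σ) :
    ‖rsSum f g n τ σ‖ ≤ F * |g b - g a|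
      + A * C * (2 * (b - a)) ^ (α + β) * ∑' k : ℕ, 1 / ((k + 1 : ℕ) : ℝ) ^ (α + β) := by
  have hba : 0 ≤ 2 * (b - a) := by linarith
  have hF0 : 0 ≤ F := (norm_nonneg _).trans (hF a (left_mem_Icc.2 hab))
  have hsummable : Summable fun k : ℕ => 1 / ((k + 1 : ℕ) : ℝ) ^ (α + β) :=
    (summable_nat_add_iff 1).2 (Real.summable_one_div_nat_rpow.2 hαβ)
  have hts : 0 ≤ ∑' k : ℕ, 1 / ((k + 1 : ℕ) : ℝ) ^ (α + β) := tsum_nonneg fun k => by positivity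
  cases n with
  | zero =>
    simp only [rsSum, Finset.range_zero, Finset.sum_empty, norm_zero]
    positivity
  | succ n =>
    have h1 := norm_rsSum_sub_le hA hC hα hβ hf hg n δ τ σ h
    have h2 : ‖f (σ 0) * ((g b - g a : ℝ) : ℂ)‖ ≤ F * |g b - g a| := by
      rw [norm_mul, Complex.norm_real, Real.norm_eq_abs]
      gcongr
      exact hF _ (h.tag_mem (by omega))
    have h3 := hsummable.sum_le_tsum (Finset.range n) fun k _ => by positivity
    have h4 : A * C * (2 * (b - a)) ^ (α + β) *
        ∑ k ∈ Finset.range n, 1 / ((k + 1 : ℕ) : ℝ) ^ (α + β) ≤ A * C * (2 * (b - a)) ^ (α + β) *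
          ∑' k : ℕ, 1 / ((k + 1 : ℕ) : ℝ) ^ (α + β) := by gcongr
    have h5 := norm_le_norm_sub_add (rsSum f g (n + 1) τ σ) (f (σ 0) * ((g b - g a : ℝ) : ℂ))
    linarith

/-! ### Young's theorem by smoothing the integrand. -/

/-- The average of `f` over `[t, t + h]`. -/
noncomputable def rightAverage (f : ℝ → ℂ) (h t : ℝ) : ℂ := ∫ u in (0 : ℝ)..1, f (t + h * u)

section RightAverage

variable {f : ℝ → ℂ} {A α h : ℝ}

theorem rightAverage_sub (hf : Continuous f) (h s t : ℝ) :
    rightAverage f h t - rightAverage f h s = ∫ u in (0 : ℝ)..1, (f (t + h * u) - f (s + h * u)) :=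
  (intervalIntegral.integral_sub (Continuous.intervalIntegrable (by fun_prop) _ _)
    (Continuous.intervalIntegrable (by fun_prop) _ _)).symm

theorem norm_rightAverage_sub_rightAverage_le (hf : Continuous f)
    (hA : ∀ s t, ‖f t - f s‖ ≤ A * |t - s| ^ α) (s t : ℝ) :
    ‖rightAverage f h t - rightAverage f h s‖ ≤ A * |t - s| ^ α := by
  rw [rightAverage_sub hf]
  have := intervalIntegral.norm_integral_le_of_norm_le_const (a := (0 : ℝ)) (b := 1)
    (f := fun u => f (t + h * u) - f (s + h * u)) (C := A * |t - s| ^ α) fun u _ => by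
      simpa using hA (s + h * u) (t + h * u)
  simpa using this

theorem norm_rightAverage_sub_le (hf : Continuous f) (hA0 : 0 ≤ A) (hα : 0 ≤ α) (hh : 0 ≤ h)
    (hA : ∀ s t, ‖f t - f s‖ ≤ A * |t - s| ^ α) (t : ℝ) :
    ‖rightAverage f h t - f t‖ ≤ A * h ^ α := by
  have e : rightAverage f h t - f t = ∫ u in (0 : ℝ)..1, (f (t + h * u) - f t) := by
    rw [intervalIntegral.integral_sub (Continuous.intervalIntegrable (by fun_prop) _ _)
      (Continuous.intervalIntegrable (by fun_prop) _ _)]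
    simp [rightAverage]
  rw [e]
  have := intervalIntegral.norm_integral_le_of_norm_le_const (a := (0 : ℝ)) (b := 1)
    (f := fun u => f (t + h * u) - f t) (C := A * h ^ α) fun u hu => by
      rw [uIoc_of_le zero_le_one] at hu
      refine (hA t (t + h * u)).trans ?_
      have hu0 : 0 ≤ h * u := mul_nonneg hh hu.1.le
      gcongr
      rw [add_sub_cancel_left, abs_of_nonneg hu0]
      exact mul_le_of_le_one_right hh hu.2
  simpa using this

/-- The average is a primitive of a continuous difference quotient, which makes it integrable
against any continuous `g` by parts. -/
theorem rightAverage_sub_eq_integral (hf : Continuous f) (hh : h ≠ 0) (s t : ℝ) :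
    rightAverage f h t - rightAverage f h s = ∫ u in s..t, h⁻¹ • (f (u + h) - f u) := by
  have e : ∀ t, rightAverage f h t = h⁻¹ • ∫ u in t..(t + h), f u := fun t => by
    rw [rightAverage, intervalIntegral.integral_comp_add_mul _ hh]
    simp
  have hi : ∀ a b : ℝ, IntervalIntegrable f volume a b := fun a b => hf.intervalIntegrable a b
  rw [intervalIntegral.integral_smul, intervalIntegral.integral_sub
    (Continuous.intervalIntegrable (by fun_prop) _ _) (hi _ _),
    intervalIntegral.integral_comp_add_right, e, e, ← smul_sub]
  congr 1
  rw [← intervalIntegral.integral_add_adjacent_intervals (hi s t) (hi t (s + h)),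
    ← intervalIntegral.integral_add_adjacent_intervals (hi t (s + h)) (hi (s + h) (t + h))]
  ring

/-- Interpolation: the average converges to `f` in every weaker Hölder norm. -/
theorem norm_rightAverage_sub_sub_le {α' : ℝ} (hf : Continuous f) (hA0 : 0 ≤ A) (hα' : 0 ≤ α')
    (hαα' : α' ≤ α) (hh : 0 < h) (hA : ∀ s t, ‖f t - f s‖ ≤ A * |t - s| ^ α) (s t : ℝ) :
    ‖(f t - rightAverage f h t) - (f s - rightAverage f h s)‖
      ≤ 2 * A * h ^ (α - α') * |t - s| ^ α' := by
  have hα : 0 ≤ α := hα'.trans hαα'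
  -- At distances below `h` the Hölder bounds of `f` and of its average suffice; above `h`, the
  -- uniform distance between them does.
  rcases le_total |t - s| h with hle | hle
  · have e : (f t - rightAverage f h t) - (f s - rightAverage f h s)
        = (f t - f s) - (rightAverage f h t - rightAverage f h s) := by ring
    have h1 := norm_sub_le (f t - f s) (rightAverage f h t - rightAverage f h s)
    have h2 := hA s t
    have h3 := norm_rightAverage_sub_rightAverage_le (h := h) hf hA s t
    have h4 : |t - s| ^ α ≤ h ^ (α - α') * |t - s| ^ α' := by
      calc |t - s| ^ α = |t - s| ^ (α - α' + α') := by rw [sub_add_cancel]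
        _ = |t - s| ^ (α - α') * |t - s| ^ α' :=
          Real.rpow_add_of_nonneg (abs_nonneg _) (sub_nonneg.2 hαα') hα'
        _ ≤ _ := by
          gcongr
    have h5 := mul_le_mul_of_nonneg_left h4 hA0
    rw [e]
    linarith
  · have h1 := norm_sub_le (f t - rightAverage f h t) (f s - rightAverage f h s)
    have h2 := norm_rightAverage_sub_le hf hA0 hα hh.le hA s
    have h3 := norm_rightAverage_sub_le hf hA0 hα hh.le hA t
    rw [norm_sub_rev] at h2 h3
    have h4 : h ^ α ≤ h ^ (α - α') * |t - s| ^ α' := by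
      calc h ^ α = h ^ (α - α' + α') := by rw [sub_add_cancel]
        _ = h ^ (α - α') * h ^ α' := Real.rpow_add hh _ _
        _ ≤ _ := by gcongr
    have h5 := mul_le_mul_of_nonneg_left h4 hA0
    linarith

end RightAverage

/-- Young's theorem: Hölder functions with exponents `α + β > 1` have a Riemann–Stieltjes
integral. -/
theorem rsIntegrable_of_holder {f : ℝ → ℂ} {g : ℝ → ℝ} {a b A C α β : ℝ} (hab : a ≤ b)
    (hA0 : 0 ≤ A) (hC : 0 ≤ C) (hβ0 : 0 ≤ β) (hβ : β < 1) (hαβ : 1 < α + β)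
    (hf : Continuous f) (hA : ∀ s t, ‖f t - f s‖ ≤ A * |t - s| ^ α)
    (hgc : ContinuousOn g (Icc a b))
    (hg : ∀ s ∈ Icc a b, ∀ t ∈ Icc a b, |g t - g s| ≤ C * |t - s| ^ β) :
    RSIntegrable f g a b := by
  -- Lowering the exponent to `α'` gains the factor `h ^ (α - α')`, which tends to `0`, while `α' +
  -- β > 1` keeps Young's inequality available. The condition `β < 1` makes `α'` nonnegative.
  obtain ⟨α', h1, h2⟩ : ∃ α', 1 - β < α' ∧ α' < α := exists_between (by linarith)
  have hα' : 0 ≤ α' := by linarith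
  refine rsIntegrable_of_approx hab fun ε hε => ?_
  set S := ∑' k : ℕ, 1 / ((k + 1 : ℕ) : ℝ) ^ (α' + β)
  have hlim : Tendsto (fun h : ℝ => A * h ^ α * |g b - g a|
      + 2 * A * h ^ (α - α') * C * (2 * (b - a)) ^ (α' + β) * S) (𝓝 0) (𝓝 0) := by
    have hc : ∀ γ : ℝ, 0 < γ → Tendsto (fun h : ℝ => h ^ γ) (𝓝 0) (𝓝 0) := fun γ hγ => by
      have := (Real.continuousAt_rpow_const 0 γ (Or.inr hγ.le)).tendsto
      rwa [Real.zero_rpow hγ.ne'] at this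
    have t1 := ((hc α (by linarith)).const_mul A).mul_const |g b - g a|
    have t2 := ((((hc (α - α') (by linarith)).const_mul (2 * A)).mul_const C).mul_const
      ((2 * (b - a)) ^ (α' + β))).mul_const S
    simpa using t1.add t2
  obtain ⟨h, hhε, hh⟩ := (((hlim.mono_left (nhdsWithin_le_nhds (s := Ioi 0))).eventually
    (gt_mem_nhds hε)).and self_mem_nhdsWithin).exists
  have hh0 : 0 < h := hh
  refine ⟨rightAverage f h, ⟨_, hasRSIntegral_of_primitive hab hgc
    (Continuous.intervalIntegrable (by fun_prop) _ _) fun s _ t _ =>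
      rightAverage_sub_eq_integral hf hh0.ne' s t⟩, fun δ n τ σ hp => ?_⟩
  rw [← rsSum_sub]
  refine (norm_rsSum_le (by positivity) hC hα' hβ0 (by linarith) hab
    (fun s _ t _ => norm_rightAverage_sub_sub_le hf hA0 hα' h2.le hh0 hA s t)
    (fun s _ => ?_) hg hp).trans hhε.le
  rw [norm_sub_rev]
  exact norm_rightAverage_sub_le hf hA0 (hα'.trans h2.le) hh0.le hA s

/-! ### Kolmogorov's continuity criterion. -/

theorem abs_sub_le_of_dyadic_step {f : ℝ → ℝ} {c : ℝ} (hc : 0 ≤ c) {n : ℕ}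
    (H : ∀ k : ℕ, k < 2 ^ n → |f ((k + 1 : ℕ) / 2 ^ n) - f (k / 2 ^ n)| ≤ c)
    {j k : ℕ} (hjk : j ≤ k) (hkj : k ≤ j + 1) (hk : k ≤ 2 ^ n) :
    |f (k / 2 ^ n) - f (j / 2 ^ n)| ≤ c := by
  rcases hjk.eq_or_lt with rfl | h
  · simpa using hc
  · obtain rfl : k = j + 1 := by omega
    exact H j (by omega)

/-- A continuous function whose dyadic increments of level `n` are at most `C 2 ^ (-α n)` is
Hölder continuous of exponent `α`. -/
theorem holder_of_dyadic {f : ℝ → ℝ} {C α : ℝ} (hC : 0 ≤ C) (hα : 0 < α)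
    (hf : ContinuousOn f (Icc 0 1))
    (H : ∀ n k : ℕ, k < 2 ^ n →
      |f ((k + 1 : ℕ) / 2 ^ n) - f (k / 2 ^ n)| ≤ C * ((2 : ℝ)⁻¹ ^ α) ^ n) :
    ∃ K, 0 ≤ K ∧ ∀ s ∈ Icc (0 : ℝ) 1, ∀ t ∈ Icc (0 : ℝ) 1, |f t - f s| ≤ K * |t - s| ^ α := by
  set r : ℝ := (2 : ℝ)⁻¹ ^ α with hr
  have hr0 : 0 < r := by positivity
  have hr1 : r < 1 := Real.rpow_lt_one (by norm_num) (by norm_num) hα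
  -- Chaining: consecutive binary truncations of `s` differ by at most one dyadic step, so the error
  -- is the tail of a geometric series of ratio `r`.
  have happrox : ∀ s ∈ Icc (0 : ℝ) 1, ∀ n : ℕ,
      |f (⌊s * 2 ^ n⌋₊ / 2 ^ n) - f s| ≤ C * r ^ n / (1 - r) := by
    intro s hs n
    have hmem : ∀ m : ℕ, (⌊s * 2 ^ m⌋₊ / 2 ^ m : ℝ) ∈ Icc (0 : ℝ) 1 := fun m => by
      refine ⟨by positivity, ?_⟩
      rw [div_le_one (by positivity)]
      refine (Nat.floor_le (mul_nonneg hs.1 (by positivity))).trans ?_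
      exact mul_le_of_le_one_left (by positivity) hs.2
    have hlim0 : Tendsto (fun m : ℕ => (⌊s * 2 ^ m⌋₊ / 2 ^ m : ℝ)) atTop (𝓝 s) :=
      (tendsto_nat_floor_mul_div_atTop hs.1).comp (tendsto_pow_atTop_atTop_of_one_lt one_lt_two)
    have hlim : Tendsto (fun m : ℕ => f (⌊s * 2 ^ m⌋₊ / 2 ^ m : ℝ)) atTop (𝓝 (f s)) :=
      (hf s hs).tendsto.comp (tendsto_nhdsWithin_iff.2 ⟨hlim0, Eventually.of_forall hmem⟩)
    refine dist_le_of_le_geometric_of_tendsto r C hr1 (fun m => ?_) hlim n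
    have h0 : 0 ≤ s * 2 ^ m := mul_nonneg hs.1 (by positivity)
    have e : s * 2 ^ (m + 1) = 2 * (s * 2 ^ m) := by ring
    have l1 : 2 * ⌊s * 2 ^ m⌋₊ ≤ ⌊s * 2 ^ (m + 1)⌋₊ := by
      refine Nat.le_floor ?_
      push_cast
      rw [e]
      linarith [Nat.floor_le h0]
    have l2 : ⌊s * 2 ^ (m + 1)⌋₊ ≤ 2 * ⌊s * 2 ^ m⌋₊ + 1 := by
      refine Nat.lt_succ_iff.1 ((Nat.floor_lt (by rw [e]; linarith)).2 ?_)
      push_cast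
      rw [e]
      linarith [Nat.lt_floor_add_one (s * 2 ^ m)]
    have l3 : ⌊s * 2 ^ (m + 1)⌋₊ ≤ 2 ^ (m + 1) := by
      refine Nat.floor_le_of_le ?_
      push_cast
      exact mul_le_of_le_one_left (by positivity) hs.2
    have := abs_sub_le_of_dyadic_step (by positivity) (H (m + 1)) l1 l2 l3
    rw [dist_comm, Real.dist_eq]
    have e2 : (((2 * ⌊s * 2 ^ m⌋₊ : ℕ) : ℝ) / 2 ^ (m + 1)) = ⌊s * 2 ^ m⌋₊ / 2 ^ m := by
      push_cast
      rw [pow_succ]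
      field_simp
    rw [e2] at this
    refine this.trans ?_
    gcongr 1
    rw [pow_succ]
    exact mul_le_of_le_one_right (by positivity) hr1.le
  -- One dyadic step at level `n` plus two tails give `1 + 2 / (1 - r)`; choosing `n` with `2⁻¹ ^ (n
  -- + 1) < t - s ≤ 2⁻¹ ^ n` costs `2 ^ α`.
  set K := C * (1 + 2 / (1 - r)) * 2 ^ α with hK
  have h1r : 0 < 1 - r := by linarith
  have hlt : ∀ s ∈ Icc (0 : ℝ) 1, ∀ t ∈ Icc (0 : ℝ) 1, s < t → |f t - f s| ≤ K * |t - s| ^ α := by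
    intro s hs t ht hst
    obtain ⟨n, hn1, hn2⟩ := exists_nat_pow_near_of_lt_one (sub_pos.2 hst)
      (by linarith [hs.1, ht.2] : t - s ≤ 1) (by norm_num : (0 : ℝ) < 2⁻¹) (by norm_num)
    have p2 : (0 : ℝ) < 2 ^ n := by positivity
    have hn2' : t * 2 ^ n ≤ s * 2 ^ n + 1 := by
      rw [inv_pow] at hn2
      have := mul_le_mul_of_nonneg_right hn2 p2.le
      rw [inv_mul_cancel₀ p2.ne'] at this
      linarith
    have l1 : ⌊s * 2 ^ n⌋₊ ≤ ⌊t * 2 ^ n⌋₊ := Nat.floor_le_floor (by gcongr)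
    have l2 : ⌊t * 2 ^ n⌋₊ ≤ ⌊s * 2 ^ n⌋₊ + 1 := by
      rw [← Nat.floor_add_one (mul_nonneg hs.1 p2.le)]
      exact Nat.floor_le_floor hn2'
    have l3 : ⌊t * 2 ^ n⌋₊ ≤ 2 ^ n := by
      refine Nat.floor_le_of_le ?_
      push_cast
      exact mul_le_of_le_one_left (by positivity) ht.2
    have b1 := abs_sub_le_of_dyadic_step (by positivity) (H n) l1 l2 l3
    have b2 := happrox s hs n
    have b3 := happrox t ht n
    have b4 : |f t - f s| ≤ C * r ^ n * (1 + 2 / (1 - r)) := by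
      have e : C * r ^ n * (1 + 2 / (1 - r)) = C * r ^ n + C * r ^ n / (1 - r)
        + C * r ^ n / (1 - r) := by ring
      rw [e]
      rw [abs_le] at *
      constructor <;> linarith [b1.1, b1.2, b2.1, b2.2, b3.1, b3.2]
    have b5 : r ^ n ≤ 2 ^ α * |t - s| ^ α := by
      rw [hr, ← Real.rpow_natCast, ← Real.rpow_mul (by norm_num), mul_comm α, Real.rpow_mul
        (by norm_num), Real.rpow_natCast, ← Real.mul_rpow (by norm_num) (abs_nonneg _),
        abs_of_pos (sub_pos.2 hst)]
      gcongr
      rw [pow_succ] at hn1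
      linarith
    refine b4.trans ?_
    rw [hK]
    calc C * r ^ n * (1 + 2 / (1 - r)) = C * (1 + 2 / (1 - r)) * r ^ n := by ring
      _ ≤ C * (1 + 2 / (1 - r)) * (2 ^ α * |t - s| ^ α) := by gcongr
      _ = _ := by ring
  refine ⟨K, by positivity, fun s hs t ht => ?_⟩
  rcases lt_trichotomy s t with h | rfl | h
  · exact hlt s hs t ht h
  · simp [Real.zero_rpow hα.ne']
  · rw [abs_sub_comm, abs_sub_comm t s]
    exact hlt t ht s hs h

/-- Kolmogorov's criterion: a process with continuous paths on `[0,1]` whose increments satisfy a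
moment bound has almost surely Hölder continuous paths. -/
theorem ae_holder_of_moment {Ω : Type*} [MeasurableSpace Ω] {P : Measure Ω} {X : ℝ → Ω → ℝ}
    {M : ℝ≥0∞} {α h : ℝ} {p : ℕ} (hα : 0 < α) (hp : 1 < p * (h - α)) (hM : M ≠ ∞)
    (hmeas : ∀ t ∈ Icc (0 : ℝ) 1, AEMeasurable (X t) P)
    (hmom : ∀ s ∈ Icc (0 : ℝ) 1, ∀ t ∈ Icc (0 : ℝ) 1,
      ∫⁻ ω, ‖X t ω - X s ω‖ₑ ^ p ∂P ≤ M * ENNReal.ofReal (|t - s| ^ h) ^ p)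
    (hcont : ∀ᵐ ω ∂P, ContinuousOn (fun t => X t ω) (Icc 0 1)) :
    ∀ᵐ ω ∂P, ∃ K, 0 ≤ K ∧ ∀ s ∈ Icc (0 : ℝ) 1, ∀ t ∈ Icc (0 : ℝ) 1,
      |X t ω - X s ω| ≤ K * |t - s| ^ α := by
  have hp0 : p ≠ 0 := by
    rintro rfl
    norm_num at hp
  set r : ℝ := (2 : ℝ)⁻¹ ^ α with hr
  have hr0 : 0 < r := by positivity
  -- Dyadic increments in units of `r ^ n`: a bound uniform in `n` and `k` is what
  -- `holder_of_dyadic` requires.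
  set D : ℕ → ℕ → Ω → ℝ := fun n k ω =>
    (r ^ n)⁻¹ * (X ((k + 1 : ℕ) / 2 ^ n) ω - X (k / 2 ^ n) ω) with hD
  have hmem : ∀ n k : ℕ, k ≤ 2 ^ n → ((k : ℝ) / 2 ^ n) ∈ Icc (0 : ℝ) 1 := fun n k hk => by
    refine ⟨by positivity, ?_⟩
    rw [div_le_one (by positivity)]
    exact_mod_cast hk
  have hDmeas : ∀ n k, k < 2 ^ n → AEMeasurable (fun ω => ‖D n k ω‖ₑ ^ p) P := fun n k hk =>
    ((((hmeas _ (hmem n (k + 1) hk)).sub (hmeas _ (hmem n k hk.le))).const_mul _).enorm.pow_const _)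
  -- the ratio of the geometric series dominating the moments
  set ρ : ℝ := 2 * (2⁻¹ ^ (h - α)) ^ p with hρ
  have hρ1 : ρ < 1 := by
    have : (2 : ℝ) * (2⁻¹ ^ (h - α)) ^ p = 2 ^ (1 - p * (h - α)) := by
      rw [← Real.rpow_natCast, ← Real.rpow_mul (by norm_num), Real.inv_rpow (by norm_num),
        Real.rpow_sub (by norm_num), Real.rpow_one, mul_comm (h - α), div_eq_mul_inv]
    rw [hρ, this]
    exact Real.rpow_lt_one_of_one_lt_of_neg one_lt_two (by linarith)
  have hDmom : ∀ n k, k < 2 ^ n →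
      ∫⁻ ω, ‖D n k ω‖ₑ ^ p ∂P ≤ M * ENNReal.ofReal ((2⁻¹ ^ (h - α)) ^ p) ^ n := by
    intro n k hk
    have e : ∀ ω, ‖D n k ω‖ₑ ^ p = ENNReal.ofReal ((r ^ n)⁻¹) ^ p
        * ‖X ((k + 1 : ℕ) / 2 ^ n) ω - X (k / 2 ^ n) ω‖ₑ ^ p := fun ω => by
      simp only [hD]
      rw [enorm_mul, mul_pow, Real.enorm_eq_ofReal (by positivity)]
    simp_rw [e]
    rw [lintegral_const_mul' _ _ (by finiteness)]
    refine (mul_le_mul_right (hmom _ (hmem n k hk.le) _ (hmem n (k + 1) hk)) _).trans ?_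
    rw [mul_left_comm]
    gcongr
    rw [← mul_pow, ← ENNReal.ofReal_mul (by positivity), ← ENNReal.ofReal_pow (by positivity),
      ← ENNReal.ofReal_pow (by positivity), ← pow_mul, mul_comm p n, pow_mul]
    refine ENNReal.ofReal_le_ofReal (pow_le_pow_left₀ (by positivity) (le_of_eq ?_) _)
    have e1 : |((k + 1 : ℕ) : ℝ) / 2 ^ n - k / 2 ^ n| = (2⁻¹ : ℝ) ^ n := by
      rw [← sub_div]
      push_cast
      rw [add_sub_cancel_left, inv_pow, one_div, abs_of_pos (by positivity)]
    rw [e1, hr, Real.rpow_sub (by norm_num), div_pow, ← Real.rpow_natCast, ← Real.rpow_natCast,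
      ← Real.rpow_natCast, ← Real.rpow_mul (by norm_num), ← Real.rpow_mul (by norm_num),
      ← Real.rpow_mul (by norm_num), mul_comm (n : ℝ) h, div_eq_inv_mul]
  -- Level `n` contributes at most `2 ^ n` moments, in total `M * ρ ^ n`. The full sum has finite
  -- expectation, so it is almost surely finite and bounds every single term.
  have hfin : ∫⁻ ω, ∑' n : ℕ, ∑ k ∈ Finset.range (2 ^ n), ‖D n k ω‖ₑ ^ p ∂P ≠ ∞ := by
    rw [lintegral_tsum fun n => Finset.aemeasurable_fun_sum _ fun k hk =>
      hDmeas n k (Finset.mem_range.1 hk)]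
    refine ne_top_of_le_ne_top (b := ∑' n : ℕ, M * ENNReal.ofReal ρ ^ n) ?_
      (ENNReal.tsum_le_tsum fun n => ?_)
    · rw [ENNReal.tsum_mul_left, ENNReal.tsum_geometric]
      refine ENNReal.mul_ne_top hM (ENNReal.inv_ne_top.2 ?_)
      rw [← ENNReal.ofReal_one, ← ENNReal.ofReal_sub _ (by positivity)]
      simpa using hρ1
    · rw [lintegral_finsetSum' _ fun k hk => hDmeas n k (Finset.mem_range.1 hk)]
      refine (Finset.sum_le_sum fun k hk => hDmom n k (Finset.mem_range.1 hk)).trans ?_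
      rw [Finset.sum_const, Finset.card_range, nsmul_eq_mul, hρ, ENNReal.ofReal_mul (by norm_num),
        mul_pow, mul_left_comm]
      simp
  have hae := ae_lt_top' (AEMeasurable.tsum fun n => Finset.aemeasurable_fun_sum _
    fun k hk => hDmeas n k (Finset.mem_range.1 hk)) hfin
  filter_upwards [hae, hcont] with ω hω hc
  set Z := ∑' n : ℕ, ∑ k ∈ Finset.range (2 ^ n), ‖D n k ω‖ₑ ^ p with hZ
  refine holder_of_dyadic (C := Z.toReal + 1) (by positivity) hα hc fun n k hk => ?_
  have h1 : ‖D n k ω‖ₑ ^ p ≤ Z :=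
    (Finset.single_le_sum (f := fun k => ‖D n k ω‖ₑ ^ p) (fun _ _ => zero_le)
      (Finset.mem_range.2 hk)).trans
      (ENNReal.le_tsum (f := fun n => ∑ k ∈ Finset.range (2 ^ n), ‖D n k ω‖ₑ ^ p) n)
  have h2 : |D n k ω| ^ p ≤ Z.toReal := by
    have := ENNReal.toReal_mono hω.ne h1
    simpa using this
  -- Adding `1` avoids taking a `p`-th root: either `|D n k ω| ≤ 1` or `|D n k ω| ≤ |D n k ω| ^ p`.
  have h3 : |D n k ω| ≤ Z.toReal + 1 := by
    rcases le_total |D n k ω| 1 with h | h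
    · linarith [ENNReal.toReal_nonneg (a := Z)]
    · linarith [le_self_pow₀ h hp0]
  simp only [hD] at h3
  rw [abs_mul, abs_of_pos (by positivity), inv_mul_le_iff₀ (by positivity)] at h3
  rw [mul_comm]
  exact h3

/-! ### Hölder regularity of Gaussian paths. -/

/-- Centred Gaussian laws are rescalings of one another, so the variance of an increment controls
all of its moments. -/
theorem lintegral_enorm_pow_gaussianReal (v : ℝ≥0) (p : ℕ) :
    ∫⁻ x, ‖x‖ₑ ^ p ∂(gaussianReal 0 v)
      = (∫⁻ x, ‖x‖ₑ ^ p ∂(gaussianReal 0 1)) * ENNReal.ofReal (√v) ^ p := by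
  have e : gaussianReal 0 v = (gaussianReal 0 1).map (√v * ·) := by
    rw [gaussianReal_map_const_mul, mul_zero, mul_one]
    congr 1
    ext
    simp
  rw [e, lintegral_map (by fun_prop) (by fun_prop)]
  simp_rw [enorm_mul, mul_pow, Real.enorm_eq_ofReal (Real.sqrt_nonneg _)]
  rw [lintegral_const_mul' _ _ (by finiteness), mul_comm]

theorem lintegral_enorm_pow_gaussianReal_ne_top (v : ℝ≥0) {p : ℕ} (hp : p ≠ 0) :
    ∫⁻ x, ‖x‖ₑ ^ p ∂(gaussianReal 0 v) ≠ ∞ := by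
  have h := (memLp_id_gaussianReal (μ := 0) (v := v) p).2
  have := lintegral_rpow_enorm_lt_top_of_eLpNorm_lt_top (by simpa using hp) (by simp) h
  simpa using this.ne

/-- A centred continuous Gaussian process on `[0,T]` whose increments have variance
`|t - s| ^ (2 * h)` has Hölder paths of every exponent less than `h`. -/
theorem ae_holder_of_isGaussianProcess {Ω : Type*} [MeasurableSpace Ω] {P : Measure Ω}
    {X : ℝ → Ω → ℝ} {T h α : ℝ} (hT : 0 < T) (hα : 0 < α) (hαh : α < h)
    (hX : IsGaussianProcess (fun (t : Icc (0 : ℝ) T) ω => X t ω) P)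
    (hmean : ∀ t ∈ Icc (0 : ℝ) T, ∫ ω, X t ω ∂P = 0)
    (hvar : ∀ s ∈ Icc (0 : ℝ) T, ∀ t ∈ Icc (0 : ℝ) T, Var[X t - X s; P] = |t - s| ^ (2 * h))
    (hcont : ∀ᵐ ω ∂P, ContinuousOn (fun t => X t ω) (Icc 0 T)) :
    ∀ᵐ ω ∂P, ∃ K, 0 ≤ K ∧ ∀ s ∈ Icc (0 : ℝ) T, ∀ t ∈ Icc (0 : ℝ) T,
      |X t ω - X s ω| ≤ K * |t - s| ^ α := by
  have hprob := hX.isProbabilityMeasure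
  have hscale : ∀ t ∈ Icc (0 : ℝ) 1, T * t ∈ Icc (0 : ℝ) T := fun t ht =>
    ⟨mul_nonneg hT.le ht.1, mul_le_of_le_one_right hT.le ht.2⟩
  -- Gaussian moments of every order exist, so `p` can be taken large enough for any `α < h`.
  obtain ⟨p, hp⟩ := exists_nat_gt (1 / (h - α))
  rw [div_lt_iff₀ (by linarith)] at hp
  have hp0 : p ≠ 0 := by
    rintro rfl
    norm_num at hp
  have hmom : ∀ s ∈ Icc (0 : ℝ) T, ∀ t ∈ Icc (0 : ℝ) T, ∫⁻ ω, ‖X t ω - X s ω‖ₑ ^ p ∂P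
      = (∫⁻ x, ‖x‖ₑ ^ p ∂(gaussianReal 0 1)) * ENNReal.ofReal (|t - s| ^ h) ^ p := by
    intro s hs t ht
    have hg : HasGaussianLaw (X t - X s) P :=
      hX.hasGaussianLaw_sub (s := ⟨t, ht⟩) (t := ⟨s, hs⟩)
    have hlaw := hg.map_eq_gaussianReal
    have hm : ∫ ω, (X t - X s) ω ∂P = 0 := by
      have h1 : Integrable (X t) P := (hX.hasGaussianLaw_eval ⟨t, ht⟩).integrable
      have h2 : Integrable (X s) P := (hX.hasGaussianLaw_eval ⟨s, hs⟩).integrable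
      simp only [Pi.sub_apply]
      rw [integral_sub h1 h2, hmean t ht, hmean s hs, sub_zero]
    rw [hm, hvar s hs t ht] at hlaw
    have e : ∫⁻ ω, ‖X t ω - X s ω‖ₑ ^ p ∂P = ∫⁻ x, ‖x‖ₑ ^ p ∂(P.map (X t - X s)) := by
      rw [lintegral_map' (by fun_prop) hg.aemeasurable]
      rfl
    rw [e, hlaw, lintegral_enorm_pow_gaussianReal]
    congr 3
    rw [Real.coe_toNNReal _ (by positivity), mul_comm, Real.rpow_mul (abs_nonneg _),
      Real.rpow_two, Real.sqrt_sq (by positivity)]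
  -- Time is rescaled to `[0,1]`; the factor `T ^ h` is absorbed into the moment constant.
  have key := ae_holder_of_moment (P := P) (X := fun t => X (T * t))
    (M := (∫⁻ x, ‖x‖ₑ ^ p ∂(gaussianReal 0 1)) * ENNReal.ofReal (T ^ h) ^ p)
    (p := p) hα hp
    (ENNReal.mul_ne_top (lintegral_enorm_pow_gaussianReal_ne_top _ hp0) (by finiteness))
    (fun t ht => hX.aemeasurable ⟨T * t, hscale t ht⟩)
    (fun s hs t ht => by
      rw [hmom _ (hscale s hs) _ (hscale t ht), mul_assoc, ← mul_pow,
        ← ENNReal.ofReal_mul (by positivity), ← mul_sub, abs_mul, abs_of_pos hT,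
        Real.mul_rpow hT.le (abs_nonneg _)])
    (hcont.mono fun ω hω => hω.comp (by fun_prop) hscale)
  filter_upwards [key] with ω ⟨K, hK, hω⟩
  refine ⟨K * (T⁻¹) ^ α, by positivity, fun s hs t ht => ?_⟩
  have hu : ∀ t ∈ Icc (0 : ℝ) T, t / T ∈ Icc (0 : ℝ) 1 := fun t ht =>
    ⟨div_nonneg ht.1 hT.le, (div_le_one hT).2 ht.2⟩
  have := hω _ (hu s hs) _ (hu t ht)
  rwa [mul_div_cancel₀ _ hT.ne', mul_div_cancel₀ _ hT.ne', ← sub_div, abs_div, abs_of_pos hT,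
    div_eq_inv_mul, Real.mul_rpow (by positivity) (abs_nonneg _), ← mul_assoc] at this

section BrownianPaths

variable {Ω : Type*} [MeasurableSpace Ω] {P : Measure Ω} {T : ℝ}

theorem IsStandardBrownianMotionOn.ae_holder {W : ℝ → Ω → ℝ}
    (hW : IsStandardBrownianMotionOn W T P) (hT : 0 < T) {α : ℝ} (hα : 0 < α) (hα2 : α < 1 / 2) :
    ∀ᵐ ω ∂P, ∃ K, 0 ≤ K ∧ ∀ s ∈ Icc (0 : ℝ) T, ∀ t ∈ Icc (0 : ℝ) T,
      |W t ω - W s ω| ≤ K * |t - s| ^ α := by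
  have hprob := hW.gaussian.isProbabilityMeasure
  have hL : ∀ t ∈ Icc (0 : ℝ) T, MemLp (W t) 2 P := fun t ht =>
    (hW.gaussian.hasGaussianLaw_eval ⟨t, ht⟩).memLp_two
  refine ae_holder_of_isGaussianProcess hT hα hα2 hW.gaussian hW.mean_zero
    (fun s hs t ht => ?_) hW.continuous
  rw [variance_sub (hL t ht) (hL s hs), ← covariance_self (hL t ht).aemeasurable,
    ← covariance_self (hL s hs).aemeasurable, hW.covariance _ ht _ ht, hW.covariance _ hs _ hs,
    hW.covariance _ ht _ hs]
  rcases le_total s t with h | h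
  · rw [min_eq_right h, abs_of_nonneg (by linarith)]
    norm_num
    ring
  · rw [min_eq_left h, abs_of_nonpos (by linarith)]
    norm_num
    ring

theorem IsFractionalBrownianMotionOn.ae_holder {B : ℝ → Ω → ℝ} {H : ℝ}
    (hB : IsFractionalBrownianMotionOn B H T P) (hT : 0 < T) {β : ℝ} (hβ : 0 < β) (hβH : β < H) :
    ∀ᵐ ω ∂P, ∃ K, 0 ≤ K ∧ ∀ s ∈ Icc (0 : ℝ) T, ∀ t ∈ Icc (0 : ℝ) T,
      |B t ω - B s ω| ≤ K * |t - s| ^ β := by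
  have hprob := hB.gaussian.isProbabilityMeasure
  have hL : ∀ t ∈ Icc (0 : ℝ) T, MemLp (B t) 2 P := fun t ht =>
    (hB.gaussian.hasGaussianLaw_eval ⟨t, ht⟩).memLp_two
  refine ae_holder_of_isGaussianProcess hT hβ hβH hB.gaussian hB.mean_zero
    (fun s hs t ht => ?_) hB.continuous
  -- The variances on the diagonal contain `0 ^ (2 * H)`, which vanishes because `H > β > 0`.
  have hz : (0 : ℝ) ^ (2 * H) = 0 := Real.zero_rpow (by linarith)
  rw [variance_sub (hL t ht) (hL s hs), ← covariance_self (hL t ht).aemeasurable,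
    ← covariance_self (hL s hs).aemeasurable, hB.covariance _ ht _ ht, hB.covariance _ hs _ hs,
    hB.covariance _ ht _ hs, sub_self, sub_self, abs_zero, hz, abs_sub_comm s t]
  ring

/-- A standard Brownian motion starts at zero. -/
theorem IsStandardBrownianMotionOn.ae_zero {W : ℝ → Ω → ℝ}
    (hW : IsStandardBrownianMotionOn W T P) (hT : 0 < T) : ∀ᵐ ω ∂P, W 0 ω = 0 := by
  have hprob := hW.gaussian.isProbabilityMeasure
  have h0 : (0 : ℝ) ∈ Icc (0 : ℝ) T := ⟨le_rfl, hT.le⟩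
  have hL : MemLp (W 0) 2 P := (hW.gaussian.hasGaussianLaw_eval ⟨0, h0⟩).memLp_two
  have hv : Var[W 0; P] = 0 := by
    rw [← covariance_self hL.aemeasurable, hW.covariance _ h0 _ h0, min_self]
  have := ae_eq_integral_of_variance_eq_zero hL hv
  rwa [hW.mean_zero 0 h0] at this

end BrownianPaths

/-! ### The rough and the smooth part of `φ_w`. -/

/-- The absolutely continuous part `φ_w(t,x) - w t = ix ∫₀ᵗ e^{ix(t-s)} w_s ds` of `φ_w(·,x)`. -/
noncomputable def phiDrift (w : ℝ → ℝ) (t x : ℝ) : ℂ :=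
  Complex.I * x * (Complex.exp (Complex.I * x * t)
    * ∫ s in (0 : ℝ)..t, (w s : ℂ) * Complex.exp (Complex.I * (-x : ℝ) * s))

/-- The time derivative of `phiDrift`. -/
noncomputable def phiDriftDeriv (w : ℝ → ℝ) (t x : ℝ) : ℂ :=
  Complex.I * x * (w t + phiDrift w t x)

theorem exp_mul_exp_neg_freq (x t : ℝ) :
    Complex.exp (Complex.I * x * t) * Complex.exp (Complex.I * (-x : ℝ) * t) = 1 := by
  rw [← Complex.exp_add]
  push_cast
  rw [show Complex.I * x * t + Complex.I * -x * t = 0 by ring, Complex.exp_zero]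

theorem norm_exp_I_mul_mul (x t : ℝ) : ‖Complex.exp (Complex.I * x * t)‖ = 1 := by
  rw [mul_assoc, ← Complex.ofReal_mul]
  exact Complex.norm_exp_I_mul_ofReal _

theorem phiPath_eq_add_phiDrift (w : ℝ → ℝ) (t x : ℝ) :
    phiPath w t x = w t + phiDrift w t x := by
  rw [phiPath, pathExpIntegral, phiDrift, mul_sub, ← mul_assoc, exp_mul_exp_neg_freq]
  push_cast
  ring

theorem phiPath_congr {w w' : ℝ → ℝ} {T t : ℝ} (h : EqOn w w' (Icc 0 T)) (ht : t ∈ Icc 0 T)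
    (x : ℝ) : phiPath w t x = phiPath w' t x := by
  rw [phiPath, phiPath, pathExpIntegral, pathExpIntegral, h ht]
  congr 3
  refine intervalIntegral.integral_congr fun s hs => ?_
  rw [uIcc_of_le ht.1] at hs
  simp only [h ⟨hs.1, hs.2.trans ht.2⟩]

section Drift

variable {w : ℝ → ℝ}

theorem continuous_phiDrift (hw : Continuous w) :
    Continuous fun p : ℝ × ℝ => phiDrift w p.1 p.2 := by
  have : Continuous fun p : ℝ × ℝ => ∫ s in (0 : ℝ)..p.1,
      (w s : ℂ) * Complex.exp (Complex.I * (-p.2 : ℝ) * s) :=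
    intervalIntegral.continuous_parametric_intervalIntegral_of_continuous
      (f := fun (p : ℝ × ℝ) s => (w s : ℂ) * Complex.exp (Complex.I * (-p.2 : ℝ) * s))
      (by fun_prop) continuous_fst
  unfold phiDrift
  fun_prop

theorem continuous_phiDriftDeriv (hw : Continuous w) :
    Continuous fun p : ℝ × ℝ => phiDriftDeriv w p.1 p.2 := by
  have := continuous_phiDrift hw
  unfold phiDriftDeriv
  fun_prop

/-- In the product rule the outer exponential reproduces `phiDrift` times `ix`; in the derivative of
the integral the two exponentials cancel and leave `ix w t`. -/
theorem hasDerivAt_phiDrift (hw : Continuous w) (x t : ℝ) :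
    HasDerivAt (fun t => phiDrift w t x) (phiDriftDeriv w t x) t := by
  have h1 : HasDerivAt (fun t : ℝ => Complex.exp (Complex.I * x * t))
      (Complex.exp (Complex.I * x * t) * (Complex.I * x)) t := by
    have := ((hasDerivAt_id (t : ℂ)).const_mul (Complex.I * x)).cexp.comp_ofReal
    simpa using this
  have hc : Continuous fun s : ℝ => (w s : ℂ) * Complex.exp (Complex.I * (-x : ℝ) * s) := by
    fun_prop
  have h2 := intervalIntegral.integral_hasDerivAt_right (hc.intervalIntegrable 0 t)
    hc.aestronglyMeasurable.stronglyMeasurableAtFilter hc.continuousAt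
  have h3 := (h1.mul h2).const_mul (Complex.I * x)
  have e := exp_mul_exp_neg_freq x t
  convert! h3 using 1
  rw [phiDriftDeriv, phiDrift]
  linear_combination (Complex.I * x * w t) * (-e)

theorem phiDrift_zero (w : ℝ → ℝ) (x : ℝ) : phiDrift w 0 x = 0 := by
  simp [phiDrift]

theorem integral_phiDriftDeriv (hw : Continuous w) (x s t : ℝ) :
    ∫ u in s..t, phiDriftDeriv w u x = phiDrift w t x - phiDrift w s x :=
  intervalIntegral.integral_eq_sub_of_hasDerivAt (fun u _ => hasDerivAt_phiDrift hw x u)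
    (((continuous_phiDriftDeriv hw).comp (by fun_prop : Continuous fun u : ℝ => (u, x))
      ).intervalIntegrable _ _)

theorem norm_phiDrift_le {M T : ℝ} (hM : ∀ s ∈ Icc 0 T, |w s| ≤ M) {t : ℝ} (ht : t ∈ Icc 0 T)
    (x : ℝ) : ‖phiDrift w t x‖ ≤ |x| * (M * T) := by
  have hM0 : 0 ≤ M := (abs_nonneg _).trans (hM t ht)
  have h1 : ‖∫ s in (0 : ℝ)..t, (w s : ℂ) * Complex.exp (Complex.I * (-x : ℝ) * s)‖
      ≤ M * |t - 0| := by
    refine intervalIntegral.norm_integral_le_of_norm_le_const fun s hs => ?_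
    rw [uIoc_of_le ht.1] at hs
    rw [norm_mul, norm_exp_I_mul_mul, mul_one, Complex.norm_real]
    exact hM s ⟨hs.1.le, hs.2.trans ht.2⟩
  rw [phiDrift, norm_mul, norm_mul, norm_mul, norm_exp_I_mul_mul, Complex.norm_I, one_mul, one_mul,
    Complex.norm_real, Real.norm_eq_abs]
  rw [sub_zero, abs_of_nonneg ht.1] at h1
  gcongr
  exact h1.trans (mul_le_mul_of_nonneg_left ht.2 hM0)

theorem norm_phiPath_le {M T : ℝ} (hM : ∀ s ∈ Icc 0 T, |w s| ≤ M) {t : ℝ} (ht : t ∈ Icc 0 T)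
    (x : ℝ) : ‖(w t : ℂ) + phiDrift w t x‖ ≤ M + |x| * (M * T) := by
  refine (norm_add_le _ _).trans (add_le_add ?_ (norm_phiDrift_le hM ht x))
  rw [Complex.norm_real]
  exact hM t ht

/-- One power of `x` comes from the time derivative and one from `phiDrift` itself; this quadratic
growth is what a finite second moment compensates. -/
theorem norm_phiDriftDeriv_le {M T : ℝ} (hM : ∀ s ∈ Icc 0 T, |w s| ≤ M) {t : ℝ}
    (ht : t ∈ Icc 0 T) (x : ℝ) :
    ‖phiDriftDeriv w t x‖ ≤ (M + M * T) * (1 + x ^ 2) := by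
  have hM0 : 0 ≤ M := (abs_nonneg _).trans (hM t ht)
  have hT : 0 ≤ T := ht.1.trans ht.2
  have h := mul_le_mul_of_nonneg_left (norm_phiPath_le hM ht x) (abs_nonneg x)
  rw [phiDriftDeriv, norm_mul, norm_mul, Complex.norm_I, one_mul, Complex.norm_real,
    Real.norm_eq_abs]
  refine h.trans ?_
  have h1 : |x| ≤ 1 + x ^ 2 := by nlinarith [sq_abs x, sq_nonneg (|x| - 1)]
  have h2 := mul_le_mul_of_nonneg_left h1 hM0
  have h3 : 0 ≤ M * T := mul_nonneg hM0 hT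
  nlinarith [sq_abs x]

end Drift

/-! ### Classical Fubini against a density with finite second moment. -/

section Density

variable {g : ℝ → ℝ}

theorem integrable_mul_of_quadratic_bound (hg : Integrable g)
    (hg2 : Integrable fun x => x ^ 2 * g x) {F : ℝ → ℂ} (hF : Continuous F) {C : ℝ}
    (hC : ∀ x, ‖F x‖ ≤ C * (1 + x ^ 2)) : Integrable fun x => F x * (g x : ℂ) := by
  refine ((hg.norm.add hg2.norm).const_mul C).mono'
    (hF.aestronglyMeasurable.mul hg.ofReal.aestronglyMeasurable) (Eventually.of_forall fun x => ?_)
  have := mul_le_mul_of_nonneg_right (hC x) (norm_nonneg (g x))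
  rw [norm_mul, Complex.norm_real]
  simp only [Pi.add_apply, norm_mul, norm_pow, Real.norm_eq_abs, sq_abs] at this ⊢
  linarith

theorem integrable_prod_mul_of_quadratic_bound (hg : Integrable g)
    (hg2 : Integrable fun x => x ^ 2 * g x) {F : ℝ → ℝ → ℂ}
    (hF : Continuous fun p : ℝ × ℝ => F p.1 p.2) {C T : ℝ}
    (hC : ∀ t ∈ Icc 0 T, ∀ x, ‖F t x‖ ≤ C * (1 + x ^ 2)) :
    Integrable (fun p : ℝ × ℝ => F p.1 p.2 * (g p.2 : ℂ))
      ((volume.restrict (Ioc 0 T)).prod volume) := by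
  have hgc : Integrable fun x => (g x : ℂ) := hg.ofReal
  refine (((hg.norm.add hg2.norm).const_mul C).comp_snd (volume.restrict (Ioc 0 T))).mono'
    (hF.aestronglyMeasurable.mul (hgc.comp_snd _).aestronglyMeasurable) ?_
  have hae : ∀ᵐ p ∂((volume.restrict (Ioc 0 T)).prod (volume : Measure ℝ)), p.1 ∈ Ioc 0 T := by
    refine Measure.quasiMeasurePreserving_fst.ae ?_
    exact ae_restrict_mem measurableSet_Ioc
  filter_upwards [hae] with p hp
  have := mul_le_mul_of_nonneg_right (hC p.1 ⟨hp.1.le, hp.2⟩ p.2) (norm_nonneg (g p.2))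
  rw [norm_mul, Complex.norm_real]
  simp only [Pi.add_apply, norm_mul, norm_pow, Real.norm_eq_abs, sq_abs] at this ⊢
  linarith

theorem integrable_integral_mul_of_quadratic_bound (hg : Integrable g)
    (hg2 : Integrable fun x => x ^ 2 * g x) {F : ℝ → ℝ → ℂ}
    (hF : Continuous fun p : ℝ × ℝ => F p.1 p.2) {C T : ℝ} (hT : 0 ≤ T)
    (hC : ∀ t ∈ Icc 0 T, ∀ x, ‖F t x‖ ≤ C * (1 + x ^ 2)) :
    Integrable fun x => (∫ t in (0 : ℝ)..T, F t x) * (g x : ℂ) := by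
  have := (integrable_prod_mul_of_quadratic_bound hg hg2 hF hC).integral_prod_right
  simp only [integral_mul_const] at this
  simpa only [intervalIntegral.integral_of_le hT] using this

theorem intervalIntegrable_integral_mul_of_quadratic_bound (hg : Integrable g)
    (hg2 : Integrable fun x => x ^ 2 * g x) {F : ℝ → ℝ → ℂ}
    (hF : Continuous fun p : ℝ × ℝ => F p.1 p.2) {C T : ℝ} (hT : 0 ≤ T)
    (hC : ∀ t ∈ Icc 0 T, ∀ x, ‖F t x‖ ≤ C * (1 + x ^ 2)) :
    IntervalIntegrable (fun t => ∫ x, F t x * (g x : ℂ)) volume 0 T := by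
  rw [intervalIntegrable_iff_integrableOn_Ioc_of_le hT]
  exact (integrable_prod_mul_of_quadratic_bound hg hg2 hF hC).integral_prod_left

theorem integral_intervalIntegral_mul_swap (hg : Integrable g)
    (hg2 : Integrable fun x => x ^ 2 * g x) {F : ℝ → ℝ → ℂ}
    (hF : Continuous fun p : ℝ × ℝ => F p.1 p.2) {C T : ℝ} (hT : 0 ≤ T)
    (hC : ∀ t ∈ Icc 0 T, ∀ x, ‖F t x‖ ≤ C * (1 + x ^ 2)) :
    ∫ x, (∫ t in (0 : ℝ)..T, F t x) * (g x : ℂ)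
      = ∫ t in (0 : ℝ)..T, ∫ x, F t x * (g x : ℂ) := by
  have := integral_integral_swap (f := fun t x => F t x * (g x : ℂ))
    (integrable_prod_mul_of_quadratic_bound hg hg2 hF hC)
  simp only [integral_mul_const] at this
  simp only [intervalIntegral.integral_of_le hT, this]

end Density

/-! ### The pathwise Fubini theorem. -/

/-- Pathwise Fubini theorem for `φ_w(t,x)`, given that `∫ w db` exists. -/
theorem phiPath_rsIntegral_fubini {T : ℝ} (hT : 0 ≤ T) {w b g : ℝ → ℝ} (hw : Continuous w)
    (hb : Continuous b) (hwb : RSIntegrable (fun t => (w t : ℂ)) b 0 T) (hg : Integrable g)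
    (hg2 : Integrable fun x => x ^ 2 * g x) :
    (∀ x : ℝ, RSIntegrable (fun t => phiPath w t x) b 0 T) ∧
    Integrable (fun x : ℝ => rsIntegral (fun t => phiPath w t x) b 0 T * (g x : ℂ)) ∧
    (∀ t ∈ Icc (0 : ℝ) T, Integrable (fun x : ℝ => phiPath w t x * (g x : ℂ))) ∧
    RSIntegrable (fun t => ∫ x : ℝ, phiPath w t x * (g x : ℂ)) b 0 T ∧
    (∫ x : ℝ, rsIntegral (fun t => phiPath w t x) b 0 T * (g x : ℂ))
      = rsIntegral (fun t => ∫ x : ℝ, phiPath w t x * (g x : ℂ)) b 0 T := by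
  obtain ⟨J, hJ⟩ := hwb
  obtain ⟨M, hM⟩ := isCompact_Icc.exists_bound_of_continuousOn (hw.continuousOn (s := Icc 0 T))
  obtain ⟨N, hN⟩ := isCompact_Icc.exists_bound_of_continuousOn (hb.continuousOn (s := Icc 0 T))
  have hM0 : 0 ≤ M := (norm_nonneg _).trans (hM 0 ⟨le_rfl, hT⟩)
  have hN0 : 0 ≤ N := (norm_nonneg _).trans (hN 0 ⟨le_rfl, hT⟩)
  have hgc : Integrable fun x => (g x : ℂ) := hg.ofReal
  have hD := continuous_phiDriftDeriv hw
  have hDb : ∀ t ∈ Icc 0 T, ∀ x, ‖phiDriftDeriv w t x‖ ≤ (M + M * T) * (1 + x ^ 2) :=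
    fun t ht x => norm_phiDriftDeriv_le hM ht x
  have hbD : Continuous fun p : ℝ × ℝ => (b p.1 : ℂ) * phiDriftDeriv w p.1 p.2 := by fun_prop
  have hbDb : ∀ t ∈ Icc 0 T, ∀ x,
      ‖(b t : ℂ) * phiDriftDeriv w t x‖ ≤ N * (M + M * T) * (1 + x ^ 2) := fun t ht x => by
    rw [norm_mul, Complex.norm_real, mul_assoc N]
    exact mul_le_mul (hN t ht) (hDb t ht x) (norm_nonneg _) hN0
  have hdrift : ∀ t ∈ Icc 0 T, Integrable fun x => phiDrift w t x * (g x : ℂ) := fun t ht => by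
    have hc : Continuous fun x => phiDrift w t x :=
      (continuous_phiDrift hw).comp (by fun_prop : Continuous fun x : ℝ => (t, x))
    refine integrable_mul_of_quadratic_bound hg hg2 hc (C := M * T) fun x => ?_
    refine (norm_phiDrift_le hM ht x).trans ?_
    rw [mul_comm]
    refine mul_le_mul_of_nonneg_left ?_ (mul_nonneg hM0 hT)
    nlinarith [sq_abs x, sq_nonneg (|x| - 1)]
  have hphi : ∀ t ∈ Icc 0 T, Integrable fun x : ℝ => phiPath w t x * (g x : ℂ) := fun t ht => by
    simp only [phiPath_eq_add_phiDrift, add_mul]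
    exact (hgc.const_mul _).add (hdrift t ht)
  -- The contribution `J` of the rough part is the same for all `x`; the rest is integration by
  -- parts in `t`.
  have hRS : ∀ x : ℝ, HasRSIntegral (fun t => phiPath w t x) b 0 T
      (J + (phiDrift w T x * b T - phiDrift w 0 x * b 0
        - ∫ t in (0 : ℝ)..T, (b t : ℂ) * phiDriftDeriv w t x)) := fun x => by
    simp only [phiPath_eq_add_phiDrift]
    refine hJ.add (hasRSIntegral_of_primitive hT hb.continuousOn ?_ fun s _ t _ =>
      (integral_phiDriftDeriv hw x s t).symm)
    exact (hD.comp (by fun_prop : Continuous fun u : ℝ => (u, x))).intervalIntegrable _ _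
  have hT' : T ∈ Icc 0 T := ⟨hT, le_rfl⟩
  have hIbD := integrable_integral_mul_of_quadratic_bound hg hg2 hbD hT hbDb
  have hsplit : ∀ x, rsIntegral (fun t => phiPath w t x) b 0 T * (g x : ℂ)
      = J * (g x : ℂ) + (phiDrift w T x * (g x : ℂ)) * b T
        - (∫ t in (0 : ℝ)..T, (b t : ℂ) * phiDriftDeriv w t x) * (g x : ℂ) := fun x => by
    rw [(hRS x).rsIntegral_eq hT, phiDrift_zero]
    ring
  have hJg : Integrable fun x => J * (g x : ℂ) := hgc.const_mul J
  have hdT : Integrable fun x => (phiDrift w T x * (g x : ℂ)) * b T := (hdrift T hT').mul_const _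
  set Ψ : ℝ → ℂ := fun t => ∫ x, phiDrift w t x * (g x : ℂ) with hΨ
  set η : ℝ → ℂ := fun t => ∫ x, phiDriftDeriv w t x * (g x : ℂ) with hη
  have hηi : IntervalIntegrable η volume 0 T :=
    intervalIntegrable_integral_mul_of_quadratic_bound hg hg2 hD hT hDb
  -- By Fubini, averaging over `x` preserves absolute continuity in `t`, so `Ψ` can also be
  -- integrated against `b` by parts.
  have hΨη : ∀ t ∈ Icc 0 T, Ψ t = ∫ s in (0 : ℝ)..t, η s := fun t ht => by
    rw [hη, ← integral_intervalIntegral_mul_swap hg hg2 hD ht.1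
      fun s hs x => hDb s ⟨hs.1, hs.2.trans ht.2⟩ x]
    simp only [integral_phiDriftDeriv hw, phiDrift_zero, sub_zero, hΨ]
  have hη0 : ∀ t ∈ Icc 0 T, IntervalIntegrable η volume 0 t := fun t ht =>
    hηi.mono_set (by rw [uIcc_of_le ht.1, uIcc_of_le hT]; exact Icc_subset_Icc_right ht.2)
  have hΨRS := hasRSIntegral_of_primitive hT hb.continuousOn hηi (f := Ψ) fun s hs t ht => by
    rw [hΨη s hs, hΨη t ht]
    exact intervalIntegral.integral_interval_sub_left (hη0 t ht) (hη0 s hs)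
  have hEq : EqOn (fun t => ∫ x : ℝ, phiPath w t x * (g x : ℂ))
      (fun t => (∫ x, (g x : ℂ)) * w t + Ψ t) (Icc 0 T) := fun t ht => by
    simp only [phiPath_eq_add_phiDrift, add_mul]
    rw [integral_add (hgc.const_mul _) (hdrift t ht), integral_const_mul, mul_comm]
  have hRS2 := (hasRSIntegral_congr hEq (eqOn_refl b _)).2
    ((hJ.const_mul (∫ x, (g x : ℂ))).add hΨRS)
  have hJgdT : Integrable fun x => J * (g x : ℂ) + (phiDrift w T x * (g x : ℂ)) * b T := hJg.add hdT
  refine ⟨fun x => ⟨_, hRS x⟩, ?_, hphi, ⟨_, hRS2⟩, ?_⟩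
  · simp only [hsplit]
    exact hJgdT.sub hIbD
  -- Both sides reduce to `J ∫ g + Ψ(T) b(T) - ∫ b η`.
  · rw [hRS2.rsIntegral_eq hT]
    simp only [hsplit]
    rw [integral_sub hJgdT hIbD, integral_add hJg hdT, integral_const_mul,
      integral_mul_const, integral_intervalIntegral_mul_swap hg hg2 hbD hT hbDb]
    have hΨ0 : Ψ 0 = 0 := by simp [hΨ, phiDrift_zero]
    simp only [mul_assoc, integral_const_mul, hΨ0, zero_mul, sub_zero]
    ring

/-- For a continuous path starting at zero, `φ_w(t,x)` is the Riemann–Stieltjes integral of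
`e^{ix(t-s)}` against `w`. -/
theorem hasRSIntegral_phiPath {w : ℝ → ℝ} {t : ℝ} (ht : 0 ≤ t) (hw : ContinuousOn w (Icc 0 t))
    (hw0 : w 0 = 0) (x : ℝ) :
    HasRSIntegral (fun s => Complex.exp (Complex.I * x * (t - s))) w 0 t (phiPath w t x) := by
  have hd : ∀ s : ℝ, HasDerivAt (fun s : ℝ => Complex.exp (Complex.I * x * (t - s)))
      (Complex.exp (Complex.I * x * (t - s)) * (Complex.I * x * (-1))) s := fun s => by
    have := (((hasDerivAt_id (s : ℂ)).const_sub (t : ℂ)).const_mul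
      (Complex.I * x)).cexp.comp_ofReal
    simpa using this
  have hc : Continuous fun s : ℝ =>
      Complex.exp (Complex.I * x * (t - s)) * (Complex.I * x * (-1)) := by fun_prop
  have key := hasRSIntegral_of_primitive ht hw (hc.intervalIntegrable 0 t) fun s _ u _ =>
    (intervalIntegral.integral_eq_sub_of_hasDerivAt (fun v _ => hd v)
      (hc.intervalIntegrable s u)).symm
  convert key using 1
  have e : ∀ s : ℝ, (w s : ℂ) * (Complex.exp (Complex.I * x * (t - s)) * (Complex.I * x * (-1)))
      = (-(Complex.I * x) * Complex.exp (Complex.I * x * t))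
        * ((w s : ℂ) * Complex.exp (Complex.I * (-x : ℝ) * s)) := fun s => by
    rw [show Complex.I * x * (t - s) = Complex.I * x * t + Complex.I * (-x : ℝ) * s by
      push_cast; ring, Complex.exp_add]
    ring
  -- The boundary term at `s = t` is `w t`, and the one at `s = 0` vanishes since `w 0 = 0`.
  simp only [e]
  rw [intervalIntegral.integral_const_mul, hw0, phiPath_eq_add_phiDrift, phiDrift]
  simp only [sub_self, mul_zero, Complex.exp_zero, Complex.ofReal_zero]
  ring

/-! ### From paths to processes. -/

theorem clamp_mem_Icc {T : ℝ} (hT : 0 ≤ T) (t : ℝ) : max 0 (min T t) ∈ Icc 0 T :=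
  ⟨le_max_left _ _, max_le hT (min_le_left _ _)⟩

/-- The projection onto the interval is 1-Lipschitz, so freezing a path outside `[0,T]` keeps its
Hölder constant. -/
theorem abs_clamp_sub_clamp_le (T s t : ℝ) :
    |max 0 (min T t) - max 0 (min T s)| ≤ |t - s| := by
  refine (abs_max_sub_max_le_max _ _ _ _).trans ?_
  rw [sub_self, abs_zero, max_eq_right (abs_nonneg _)]
  refine (abs_min_sub_min_le_max _ _ _ _).trans ?_
  rw [sub_self, abs_zero, max_eq_right (abs_nonneg _)]

/-- A density of a square integrable random variable has a finite second moment. -/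
theorem integrable_density_and_sq_mul {Ω : Type*} [MeasurableSpace Ω] {P : Measure Ω}
    [IsProbabilityMeasure P] {ξ : Ω → ℝ} (hξ : MemLp ξ 2 P) {g : ℝ → ℝ} (hg : Measurable g)
    (hg0 : ∀ x, 0 ≤ g x) (hξg : HasLaw ξ (volume.withDensity fun x => ENNReal.ofReal (g x)) P) :
    Integrable g ∧ Integrable fun x => x ^ 2 * g x := by
  have hm : Measurable fun x => ENNReal.ofReal (g x) := hg.ennreal_ofReal
  have hf : ∀ᵐ x, ENNReal.ofReal (g x) < ∞ := Eventually.of_forall fun x => ENNReal.ofReal_lt_top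
  have key : ∀ F : ℝ → ℝ, Measurable F → Integrable (fun ω => F (ξ ω)) P →
      Integrable fun x => F x * g x := by
    intro F hF hi
    have h1 : Integrable F (P.map ξ) :=
      (integrable_map_measure hF.aestronglyMeasurable hξg.aemeasurable).2 hi
    rw [hξg.map_eq, integrable_withDensity_iff hm hf] at h1
    simpa only [ENNReal.toReal_ofReal (hg0 _)] using h1
  refine ⟨?_, key (fun x => x ^ 2) (by fun_prop) hξ.integrable_sq⟩
  simpa using key (fun _ => 1) measurable_const (integrable_const _)

theorem proposition2p7 {Ω : Type*} [MeasurableSpace Ω] (P : Measure Ω) [IsProbabilityMeasure P]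
    (T : ℝ) (hT : 0 < T) (H : ℝ) (hH : H ∈ Ioo (1 / 2 : ℝ) 1)
    (W B : ℝ → Ω → ℝ)
    (hW : IsStandardBrownianMotionOn W T P)
    (hB : IsFractionalBrownianMotionOn B H T P)
    (hWB : IndepFun (fun ω (t : Icc (0 : ℝ) T) => W t ω) (fun ω (t : Icc (0 : ℝ) T) => B t ω) P)
    (ξ : Ω → ℝ) (hξ : MemLp ξ 2 P)
    (g : ℝ → ℝ) (hg : Measurable g) (hg0 : ∀ x, 0 ≤ g x)
    (hξg : HasLaw ξ (volume.withDensity fun x => ENNReal.ofReal (g x)) P)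
    (hξX : IndepFun ξ (fun ω (t : Icc (0 : ℝ) T) => W t ω + B t ω) P) :
    ∀ᵐ ω ∂P,
      -- `φ_W(t,x)` is the limit of the Riemann–Stieltjes sums of `∫₀ᵗ e^{ix(t-s)} dW_s`
      (∀ t ∈ Icc (0 : ℝ) T, ∀ x : ℝ,
        HasRSIntegral (fun s => Complex.exp (Complex.I * x * (t - s))) (fun s => W s ω) 0 t
          (phiPath (fun s => W s ω) t x)) ∧
      -- the iterated integral `I₁` exists
      (∀ x : ℝ, RSIntegrable (fun t => phiPath (fun s => W s ω) t x) (fun t => B t ω) 0 T) ∧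
      Integrable (fun x : ℝ =>
        rsIntegral (fun t => phiPath (fun s => W s ω) t x) (fun t => B t ω) 0 T * (g x : ℂ)) ∧
      -- the iterated integral `I₂` exists
      (∀ t ∈ Icc (0 : ℝ) T,
        Integrable (fun x : ℝ => phiPath (fun s => W s ω) t x * (g x : ℂ))) ∧
      RSIntegrable (fun t => ∫ x : ℝ, phiPath (fun s => W s ω) t x * (g x : ℂ))
        (fun t => B t ω) 0 T ∧
      -- `I₁ = I₂`
      (∫ x : ℝ, rsIntegral (fun t => phiPath (fun s => W s ω) t x) (fun t => B t ω) 0 T * (g x : ℂ))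
        = rsIntegral (fun t => ∫ x : ℝ, phiPath (fun s => W s ω) t x * (g x : ℂ))
            (fun t => B t ω) 0 T := by
  obtain ⟨hH1, hH2⟩ := hH
  obtain ⟨β, hβ1, hβ2⟩ : ∃ β, 1 / 2 < β ∧ β < H := exists_between hH1
  -- The interval for `α` is nonempty because `β > 1/2`; then `α + β > 1`.
  obtain ⟨α, hα1, hα2⟩ : ∃ α, 1 - β < α ∧ α < 1 / 2 := exists_between (by linarith)
  obtain ⟨hgi, hg2⟩ := integrable_density_and_sq_mul hξ hg hg0 hξg
  -- The exceptional null set involves only properties of the paths of `W` and `B`, so it serves all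
  -- `t` and `x` at once.
  filter_upwards [hW.ae_holder hT (α := α) (by linarith) hα2,
    hB.ae_holder hT (β := β) (by linarith) hβ2, hW.ae_zero hT, hW.continuous, hB.continuous]
    with ω ⟨A, hA, hWA⟩ ⟨C, hC, hBC⟩ hW0 hWc hBc
  refine ⟨fun t ht x => hasRSIntegral_phiPath ht.1
    (hWc.mono (Icc_subset_Icc_right ht.2)) hW0 x, ?_⟩
  -- The analytic lemmas ask for paths continuous on all of `ℝ`; the integrals over `[0,T]` do not
  -- see the extension.
  set w : ℝ → ℝ := fun t => W (max 0 (min T t)) ω with hw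
  set b : ℝ → ℝ := fun t => B (max 0 (min T t)) ω with hb
  have hclamp : ∀ t ∈ Icc 0 T, max 0 (min T t) = t := fun t ht => by
    rw [min_eq_right ht.2, max_eq_right ht.1]
  have hwW : EqOn (fun t => W t ω) w (Icc 0 T) := fun t ht => by simp only [hw, hclamp t ht]
  have hbB : EqOn (fun t => B t ω) b (Icc 0 T) := fun t ht => by simp only [hb, hclamp t ht]
  have hwc : Continuous w := hWc.comp_continuous (f := fun t => max 0 (min T t)) (by fun_prop)
    (clamp_mem_Icc hT.le)
  have hbc : Continuous b := hBc.comp_continuous (f := fun t => max 0 (min T t)) (by fun_prop)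
    (clamp_mem_Icc hT.le)
  have hwH : ∀ s t, ‖(w t : ℂ) - w s‖ ≤ A * |t - s| ^ α := fun s t => by
    rw [← Complex.ofReal_sub, Complex.norm_real]
    refine (hWA _ (clamp_mem_Icc hT.le s) _ (clamp_mem_Icc hT.le t)).trans ?_
    refine mul_le_mul_of_nonneg_left (Real.rpow_le_rpow (abs_nonneg _)
      (abs_clamp_sub_clamp_le T s t) (by linarith)) hA
  have hbH : ∀ s ∈ Icc 0 T, ∀ t ∈ Icc 0 T, |b t - b s| ≤ C * |t - s| ^ β := fun s hs t ht => by
    rw [← hbB hs, ← hbB ht]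
    exact hBC s hs t ht
  have hwb : RSIntegrable (fun t => (w t : ℂ)) b 0 T :=
    rsIntegrable_of_holder hT.le hA hC (by linarith) (by linarith) (by linarith)
      (by fun_prop) hwH hbc.continuousOn hbH
  have hphi : ∀ x, EqOn (fun t => phiPath (fun s => W s ω) t x) (fun t => phiPath w t x)
      (Icc 0 T) := fun x t ht => phiPath_congr hwW ht x
  have hphi2 : EqOn (fun t => ∫ x : ℝ, phiPath (fun s => W s ω) t x * (g x : ℂ))
      (fun t => ∫ x : ℝ, phiPath w t x * (g x : ℂ)) (Icc 0 T) := fun t ht => by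
    simp only [phiPath_congr hwW ht]
  obtain ⟨h1, h2, h3, h4, h5⟩ := phiPath_rsIntegral_fubini hT.le hwc hbc hwb hgi hg2
  simp only [rsIntegral_congr hphi2 hbB, rsIntegral_congr (hphi _) hbB,
    rsIntegrable_congr hphi2 hbB, rsIntegrable_congr (hphi _) hbB]
  exact ⟨h1, h2, fun t ht => by simpa only [phiPath_congr hwW ht] using h3 t ht, h4, h5⟩
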